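/- Let $d\in\{1,2,3\}$, let $\hat\Omega_h\subset\mathbb R^d$ be a bounded polyhedral reference domain with a face-to-face simplicial mesh $\mathcal T_h$, let $\Delta t>0$, $N\ge 0$, $t^n=n\Delta t$ and $t^{n+1/2}=t^n+\Delta t/2$. Let $\mathcal A_{h,t^n}$, $0\le n\le N+1$, be continuous maps on $\hat\Omega_h$ that are affine on each cell, and let $\mathcal A_{h,\Delta t}(\cdot,\tau)$ be their linear interpolation in time on each $[t^n,t^{n+1}]$, assumed injective on $\hat\Omega_h$ for every $\tau$. Write $\Omega_\tau$ and $K_\tau$ for the images of $\hat\Omega_h$ and of a cell $K$, $\Omega_{t^{n+1/2}}$, $K_{t^{n+1/2}}$ being the images at the midpoint; $h_{K}$ is the diameter of $K_{t^{n+1/2}}$. The mesh velocity $\mathbf w_h$ on $\Omega_{t^{n+1/2}}$ is $\hat{\mathbf w}_h^{n+1}=(\mathcal A_{h,t^{n+1}}-\mathcal A_{h,t^n})/\Delta t$ composed with the inverse of the ALE map at $t^{n+1/2}$. If $d=3$, assume the geometric conservation law: $|K_{t^{n+1}}|-|K_{t^n}|=\Delta t\int_{K_{t^{n+1/2}}}\nabla\cdot\mathbf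 w_h\,dx$ for all cells and all $n\le N$ (for $d\le 2$ it holds automatically). Let $V_h$ be a finite-dimensional space of continuous functions on $\hat\Omega_h$, polynomial on each cell, that vanish on the boundary of $\hat\Omega_h$ and, transported by the ALE map, on the boundary of $\Omega_\tau$ for each $\tau\in[0,t^{N+1}]$ (a conforming finite element space in $H^1_0$); functions in $V_h$ are transported to each $\Omega_\tau$ by the ALE map. Let $\epsilon,\mu>0$, let $\mathbf b(t,\cdot)\in C^1(\mathbb R^d)^d$ and $c(t,\cdot)\in C(\mathbb R^d)$ for $t\in[0,t^{N+1}]$, write $f^{n+1/2}=f(t^{n+1/2},\cdot)\in L^2(\Omega_{t^{n+1/2}})$, and assume $\mu\le c-\tfrac12\nabla\cdot\mathbf b$ on $\Omega_{t^{n+1/2}}$ at time $t^{n+1/2}$, $0\le n\le N$. Let $c_{inv}\ge 0$ be a constant with $\|\Delta v\|_{0,K}\le c_{inv}h_K^{-1}|v|_{1,K}$ for all $v\in V_h$ and all cells $K_{t^{n+1/2}}$, $0\le n\le N$, and let the stabilization parameters $\delta_K\ge 0$, $K\in\mathcal T_h$, satisfy, at all times $t^{n+1/2}$, $$2\,\delta_K\|c\|_{K,\infty}^2\le\mu,\qquad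 2\,\delta_K\,\epsilon\, c_{inv}^2\le h_K^2,\qquad \delta_K\le\frac{\Delta t}{4}.$$ Put $\boldsymbol\beta=\mathbf b(s_n,\cdot)-\mathbf w_h$ on $\Omega_{t^{n+1/2}}$ with an arbitrary $s_n\in[t^n,t^{n+1}]$ (in particular $s_n=t^{n+1/2}$ or $s_n=t^{n+1}$), and $$a_{SUPG}^{n+1/2}(u,v)=\epsilon(\nabla u,\nabla v)+(\mathbf b\cdot\nabla u,v)+(cu,v)+\sum_K\delta_K(-\epsilon\Delta u+\boldsymbol\beta\cdot\nabla u+cu,\boldsymbol\beta\cdot\nabla v)_K,$$ $$|||u|||^2=\epsilon|u|_1^2+\sum_K\delta_K\|\boldsymbol\beta\cdot\nabla u\|_{0,K}^2+\mu\|u\|_0^2,$$ all on $\Omega_{t^{n+1/2}}$ with its moved cells, with $\mathbf b,c$ otherwise taken at $t^{n+1/2}$. Let $u_h^0,\dots,u_h^{N+1}\in V_h$ satisfy, for $0\le n\le N$ and all $v_h\in V_h$, the backward Euler conservative ALE-SUPG scheme with midpoint quadrature $$\frac1{\Delta t}\Big((u_h^{n+1},v_h)_{\Omega_{t^{n+1}}}-(u_h^n,v_h)_{\Omega_{t^n}}\Big)+a_{SUPG}^{n+1/2}(u_h^{n+1},v_h)-\int_{\Omega_{t^{n+1/2}}}\nabla\cdot(\mathbf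 w_hu_h^{n+1})\,v_h\,dx$$ $$=\int_{\Omega_{t^{n+1/2}}}f^{n+1/2}v_h\,dx+\sum_K\delta_K\int_{K_{t^{n+1/2}}}f^{n+1/2}\,\boldsymbol\beta\cdot\nabla v_h\,dx .$$ Then $$\|u_h^{N+1}\|^2_{L^2(\Omega_{t^{N+1}})}+\frac{\Delta t}2\sum_{n=0}^N|||u_h^{n+1}|||^2_{\Omega_{t^{n+1/2}}}\le\|u_h^0\|^2_{L^2(\Omega_{t^0})}+\frac{2\Delta t}{\mu}\sum_{n=0}^N\|f^{n+1/2}\|^2_{L^2(\Omega_{t^{n+1/2}})}+2\Delta t\sum_{K}\delta_K\sum_{n=0}^N\|f^{n+1/2}\|^2_{L^2(\Omega_{t^{n+1/2}})} .$$ -/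

import Mathlib

open MeasureTheory Set
open scoped RealInnerProductSpace

namespace ALESUPG

noncomputable section

/-- The space `ℝ^d` with its Euclidean structure. -/
abbrev Pt (d : ℕ) : Type := EuclideanSpace ℝ (Fin d)

/-- A triangulation by simplices of a bounded polyhedral reference domain in `ℝ^d`:
a finite (face-to-face) simplicial complex all of whose simplices are faces of `d`-simplices. -/
structure Mesh (d : ℕ) extends Geometry.SimplicialComplex ℝ (Pt d) where
  finite : faces.Finite
  pure : ∀ s ∈ faces, ∃ K ∈ faces, s ⊆ K ∧ K.card = d + 1

namespace Mesh

variable {d : ℕ} (T : Mesh d)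

/-- The (closed) reference domain. -/
def domain : Set (Pt d) := T.toSimplicialComplex.space

/-- The mesh cells, each given by its `d + 1` vertices. -/
def cells : Finset (Finset (Pt d)) := T.finite.toFinset.filter (fun K => K.card = d + 1)

end Mesh

/-- The closed simplex with vertex set `K`. -/
def cell {d : ℕ} (K : Finset (Pt d)) : Set (Pt d) := convexHull ℝ (K : Set (Pt d))

/-- The Eulerian version `v ∘ a⁻¹`, on the moved domain `a (Ω̂)`, of a function `v` on the reference
domain `Ω̂`, for a map `a` which is injective on `Ω̂`. -/
def eulerian {d : ℕ} {F : Type*} (T : Mesh d) (a : Pt d → Pt d) (v : Pt d → F) : Pt d → F :=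
  fun x => v (Function.invFunOn a T.domain x)

/-- The divergence of a vector field. -/
def divergence {d : ℕ} (v : Pt d → Pt d) (x : Pt d) : ℝ :=
  ∑ i : Fin d, (fderiv ℝ v x (EuclideanSpace.single i 1)) i

/-- The squared `L²(S)` norm of a function. -/
def l2sq {d : ℕ} (S : Set (Pt d)) (v : Pt d → ℝ) : ℝ := ∫ x in S, v x ^ 2

/-- The supremum norm of a (continuous) function on a (compact) set. -/
def supNorm {d : ℕ} (S : Set (Pt d)) (v : Pt d → ℝ) : ℝ := sSup ((fun x => |v x|) '' S)

/-! ### Time grid and discrete ALE map -/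

/-- The time `t^n` of the uniform grid. -/
def gridTime (Δt : ℝ) (n : ℕ) : ℝ := n * Δt

/-- The midpoint `t^{n+1/2}` of the `n`-th time interval. -/
def midTime (Δt : ℝ) (n : ℕ) : ℝ := gridTime Δt n + Δt / 2

/-- The ALE map at time `τ ∈ [t^n, t^{n+1}]`, interpolated linearly in time. -/
def aleMap {d : ℕ} (Δt : ℝ) (A : ℝ → Pt d → Pt d) (n : ℕ) (τ : ℝ) (Y : Pt d) : Pt d :=
  ((τ - gridTime Δt n) / Δt) • A (gridTime Δt (n + 1)) Y
    + ((gridTime Δt (n + 1) - τ) / Δt) • A (gridTime Δt n) Y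

/-- The ALE map at the midpoint `t^{n+1/2}`. -/
def midMap {d : ℕ} (Δt : ℝ) (A : ℝ → Pt d → Pt d) (n : ℕ) : Pt d → Pt d :=
  aleMap Δt A n (midTime Δt n)

/-- The discrete mesh velocity on `[t^n, t^{n+1}]` in the ALE frame, constant in time. -/
def refVelocity {d : ℕ} (Δt : ℝ) (A : ℝ → Pt d → Pt d) (n : ℕ) (Y : Pt d) : Pt d :=
  (1 / Δt) • (A (gridTime Δt (n + 1)) Y - A (gridTime Δt n) Y)

/-- The domain `Ω_{h,t^n}`. -/
def gridDomain {d : ℕ} (T : Mesh d) (Δt : ℝ) (A : ℝ → Pt d → Pt d) (n : ℕ) : Set (Pt d) :=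
  A (gridTime Δt n) '' T.domain

/-- The domain `Ω_{h,t^{n+1/2}}`. -/
def midDomain {d : ℕ} (T : Mesh d) (Δt : ℝ) (A : ℝ → Pt d → Pt d) (n : ℕ) : Set (Pt d) :=
  midMap Δt A n '' T.domain

/-- The cell `K` at time `t^n`. -/
def gridCell {d : ℕ} (Δt : ℝ) (A : ℝ → Pt d → Pt d) (n : ℕ) (K : Finset (Pt d)) : Set (Pt d) :=
  A (gridTime Δt n) '' cell K

/-- The cell `K` at time `t^{n+1/2}`. -/
def midCell {d : ℕ} (Δt : ℝ) (A : ℝ → Pt d → Pt d) (n : ℕ) (K : Finset (Pt d)) : Set (Pt d) :=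
  midMap Δt A n '' cell K

/-- The mesh velocity on `Ω_{h,t^{n+1/2}}` in the Eulerian frame. -/
def meshVelocity {d : ℕ} (T : Mesh d) (Δt : ℝ) (A : ℝ → Pt d → Pt d) (n : ℕ) : Pt d → Pt d :=
  eulerian T (midMap Δt A n) (refVelocity Δt A n)

/-- `A` is a discrete ALE motion on `[0, t^{N+1}]`: at the grid times it is continuous and affine
on each reference cell (continuity is contained in the agreement with an affine map on each
*closed* cell), and its piecewise linear interpolation in time is injective on the reference
domain, hence a bijection of it onto its image, at every time. -/
structure IsALEMotion {d : ℕ} (T : Mesh d) (Δt : ℝ) (N : ℕ) (A : ℝ → Pt d → Pt d) : Prop where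
  affine : ∀ n ≤ N + 1, ∀ K ∈ T.cells, ∃ g : Pt d →ᵃ[ℝ] Pt d,
    EqOn (A (gridTime Δt n)) g (cell K)
  injOn : ∀ n ≤ N, ∀ τ ∈ Icc (gridTime Δt n) (gridTime Δt (n + 1)),
    InjOn (aleMap Δt A n τ) T.domain

/-- The geometric conservation law: for every cell and every time step, the midpoint rule
integrates exactly the change `∫_{t^n}^{t^{n+1}} ∫_{K_t} ∇·w_h dx dt` of the volume of the cell. -/
def GCL {d : ℕ} (T : Mesh d) (Δt : ℝ) (N : ℕ) (A : ℝ → Pt d → Pt d) : Prop :=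
  ∀ n ≤ N, ∀ K ∈ T.cells,
    volume.real (gridCell Δt A (n + 1) K) - volume.real (gridCell Δt A n K)
      = Δt * ∫ x in midCell Δt A n K, divergence (meshVelocity T Δt A n) x

/-! ### The finite element space -/

/-- `V` is (in the ALE frame) a conforming finite element space: its members are continuous,
polynomial on each closed reference cell (agreement with a polynomial on each *closed* cell contains
the continuity), vanish on the boundary of the reference domain, and their Eulerian versions vanish
on the boundary of the moved domain at each time in `[0, t^{N+1}]`. So their Eulerian versions are
the piecewise polynomial functions of a subspace of `H¹₀(Ω_{h,t})`. Only the restrictions of the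
members of `V` to the reference domain matter. -/
structure IsConforming {d : ℕ} (T : Mesh d) (Δt : ℝ) (N : ℕ) (A : ℝ → Pt d → Pt d)
    (V : Submodule ℝ (Pt d → ℝ)) : Prop where
  polynomial : ∀ v ∈ V, ∀ K ∈ T.cells, ∃ p : MvPolynomial (Fin d) ℝ,
    ∀ x ∈ cell K, v x = MvPolynomial.eval (fun i => x i) p
  zero_ref : ∀ v ∈ V, ∀ x ∈ frontier T.domain, v x = 0
  zero_moved : ∀ v ∈ V, ∀ n ≤ N, ∀ τ ∈ Icc (gridTime Δt n) (gridTime Δt (n + 1)),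
    ∀ x ∈ frontier (aleMap Δt A n τ '' T.domain), eulerian T (aleMap Δt A n τ) v x = 0

/-- `cinv` is a constant of the inverse inequality `‖Δ v‖_{0,K} ≤ cinv h_K⁻¹ |v|_{1,K}`
(here squared) for all finite element functions, on all cells at the times `t^{n+1/2}`. -/
def IsInverseConstant {d : ℕ} (T : Mesh d) (Δt : ℝ) (N : ℕ) (A : ℝ → Pt d → Pt d)
    (V : Submodule ℝ (Pt d → ℝ)) (cinv : ℝ) : Prop :=
  0 ≤ cinv ∧ ∀ n ≤ N, ∀ K ∈ T.cells, ∀ v ∈ V,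
    (∫ x in midCell Δt A n K, (Laplacian.laplacian (eulerian T (midMap Δt A n) v) x) ^ 2)
      ≤ (cinv / Metric.diam (midCell Δt A n K)) ^ 2
        * ∫ x in midCell Δt A n K, ‖gradient (eulerian T (midMap Δt A n) v) x‖ ^ 2

/-! ### The scheme

Derivatives of Eulerian finite element functions are the classical ones in the interiors of the
cells, which cover the domain up to a null set. -/

/-- The SUPG bilinear form on `a (Ω̂)`; `b` is the convective velocity in the Galerkin part and
`β` the velocity (convective minus mesh velocity) in the stabilization. -/
def supgForm {d : ℕ} (T : Mesh d) (a : Pt d → Pt d) (δ : Finset (Pt d) → ℝ) (ε : ℝ)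
    (b β : Pt d → Pt d) (c : Pt d → ℝ) (u v : Pt d → ℝ) : ℝ :=
  ε * (∫ x in a '' T.domain, ⟪gradient u x, gradient v x⟫)
    + (∫ x in a '' T.domain, ⟪b x, gradient u x⟫ * v x)
    + (∫ x in a '' T.domain, c x * u x * v x)
    + ∑ K ∈ T.cells, δ K * ∫ x in a '' cell K,
        (-ε * Laplacian.laplacian u x + ⟪β x, gradient u x⟫ + c x * u x) * ⟪β x, gradient v x⟫

/-- The square `|||u|||²` of the mesh dependent norm on `a (Ω̂)`. -/
def supgNormSq {d : ℕ} (T : Mesh d) (a : Pt d → Pt d) (δ : Finset (Pt d) → ℝ) (ε μ : ℝ)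
    (β : Pt d → Pt d) (u : Pt d → ℝ) : ℝ :=
  ε * (∫ x in a '' T.domain, ‖gradient u x‖ ^ 2)
    + (∑ K ∈ T.cells, δ K * l2sq (a '' cell K) (fun x => ⟪β x, gradient u x⟫))
    + μ * l2sq (a '' T.domain) u

/-- The velocity `b - w_h` in the stabilization terms of step `n`, on `Ω_{h,t^{n+1/2}}`,
with `b` taken at time `s n`. -/
def relVelocity {d : ℕ} (T : Mesh d) (Δt : ℝ) (A : ℝ → Pt d → Pt d) (b : ℝ → Pt d → Pt d)
    (s : ℕ → ℝ) (n : ℕ) (x : Pt d) : Pt d :=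
  b (s n) x - meshVelocity T Δt A n x

/-- `u` (given in the ALE frame) satisfies the `n`-th step of the conservative ALE-SUPG scheme with
the implicit Euler method and the midpoint rule for the evolution of the domain. -/
def SchemeStep {d : ℕ} (T : Mesh d) (Δt : ℝ) (A : ℝ → Pt d → Pt d)
    (V : Submodule ℝ (Pt d → ℝ)) (δ : Finset (Pt d) → ℝ) (ε : ℝ)
    (b : ℝ → Pt d → Pt d) (c f : ℝ → Pt d → ℝ) (s : ℕ → ℝ)
    (u : ℕ → Pt d → ℝ) (n : ℕ) : Prop :=
  let E (v : Pt d → ℝ) : Pt d → ℝ := eulerian T (midMap Δt A n) v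
  let t : ℝ := midTime Δt n
  let β : Pt d → Pt d := relVelocity T Δt A b s n
  ∀ v ∈ V,
    (1 / Δt) *
        ((∫ x in gridDomain T Δt A (n + 1),
            eulerian T (A (gridTime Δt (n + 1))) (u (n + 1)) x
              * eulerian T (A (gridTime Δt (n + 1))) v x)
          - ∫ x in gridDomain T Δt A n,
              eulerian T (A (gridTime Δt n)) (u n) x * eulerian T (A (gridTime Δt n)) v x)
      + supgForm T (midMap Δt A n) δ ε (b t) β (c t) (E (u (n + 1))) (E v)
      - (∫ x in midDomain T Δt A n,
          divergence (fun y => E (u (n + 1)) y • meshVelocity T Δt A n y) x * E v x)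
    = (∫ x in midDomain T Δt A n, f t x * E v x)
      + ∑ K ∈ T.cells, δ K * ∫ x in midCell Δt A n K, f t x * ⟪β x, gradient (E v) x⟫

end

end ALESUPG

open ALESUPG

/-! Test step `n` with `u (n + 1)` and multiply by `2 * Δt`. Three facts turn the resulting identity
into an energy inequality that telescopes.

Mass and mesh velocity. The function `u (n + 1)` is fixed in the reference frame, and on each cell
the Jacobians of the ALE maps and the divergence of `w_h` are constant. The geometric conservation
law for volumes therefore extends to every transported integrand, in particular to the square of `u
(n + 1)` (`IsALEMotion.l2sq_sub`): the change of its squared norm from `t^n` to `t^{n+1}` is `Δt ∫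
u² ∇·w_h` at the midpoint. Integration by parts turns the mesh velocity term of the scheme into half
of the same integral. Once the mixed product on the old domain is split by Young's inequality, the
two contributions cancel exactly, with no condition on `Δt`. For `d ≤ 2` the conservation law
follows from `det (1 + X/2) - det (1 - X/2) = tr X` and from the constant sign of the Jacobian along
the injective motion (`IsALEMotion.gcl`).

Coercivity (`supgForm_coercive`). Integration by parts of the convection leaves the reaction
coefficient `c - ½ ∇·b ≥ μ`. The bounds on `δ` let the stabilization consume at most half of the
diffusion and of the reaction, while half of the streamline term survives.

Load (`load_upper_bound`). Young's inequality costs a quarter of `|||u|||²`, so a quarter remains,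
which becomes `Δt / 2` after the multiplication.

Integration by parts for cellwise smooth functions rests on
`IsCellFamily.integral_divergence_eq_zero`: a field vanishing on the boundary has a globally
Lipschitz extension by zero, and the directional derivatives of a compactly supported Lipschitz
function integrate to zero. -/

namespace ALESUPG

noncomputable section

open Filter Topology
open scoped NNReal

/-! ### Lipschitz functions and finite closed covers -/

/-- A function on a normed space that is Lipschitz on each member of a finite closed cover is
Lipschitz with the same constant. -/
theorem lipschitzWith_of_finite_closed_cover {E F ι : Type*} [NormedAddCommGroup E]
    [NormedSpace ℝ E] [PseudoMetricSpace F] {s : Finset ι} {C : ι → Set E}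
    (hC : ∀ i ∈ s, IsClosed (C i)) (hcov : ∀ x, ∃ i ∈ s, x ∈ C i) {f : E → F} {L : ℝ≥0}
    (hL : ∀ i ∈ s, LipschitzOnWith L f (C i)) : LipschitzWith L f := by
  -- Near `x` only the closed sets containing `x` occur, so every nearby `y` shares one of them with
  -- `x`. Two nearby points need not share one with each other, so this is weaker than a local
  -- Lipschitz bound.
  have hloc : ∀ x, ∀ᶠ y in 𝓝 x, dist (f y) (f x) ≤ L * dist y x := by
    intro x
    have h1 : ∀ᶠ y in 𝓝 x, ∀ i ∈ s, x ∉ C i → y ∉ C i := by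
      rw [Filter.eventually_all_finset]
      intro i hi
      by_cases hx : x ∈ C i
      · exact Eventually.of_forall fun y h => absurd hx h
      · filter_upwards [(hC i hi).isOpen_compl.mem_nhds hx] with y hy _ using hy
    filter_upwards [h1] with y hy
    obtain ⟨i, hi, hyi⟩ := hcov y
    have hxi : x ∈ C i := by
      by_contra h
      exact hy i hi h hyi
    exact (hL i hi).dist_le_mul y hyi x hxi
  have hcont : Continuous f := by
    rw [continuous_iff_continuousAt]
    intro x
    rw [ContinuousAt, tendsto_iff_dist_tendsto_zero]
    refine squeeze_zero' (Eventually.of_forall fun _ => dist_nonneg) (hloc x) ?_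
    have : Tendsto (fun y => (L : ℝ) * dist y x) (𝓝 x) (𝓝 (L * dist x x)) :=
      (continuous_const.mul (continuous_id.dist continuous_const)).tendsto x
    simpa using this
  refine LipschitzWith.of_dist_le_mul fun y x => ?_
  let γ : ℝ → E := fun t => AffineMap.lineMap x y t
  have hγ : Continuous γ := AffineMap.lineMap_continuous
  have hdist : ∀ t t', dist (γ t) (γ t') = |t - t'| * dist x y := by
    intro t t'
    simp only [γ, dist_lineMap_lineMap, Real.dist_eq]
  let S : Set ℝ := {t | dist (f (γ t)) (f x) ≤ L * (t * dist x y)}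
  have hS : IsClosed S := isClosed_le ((hcont.comp hγ).dist continuous_const) (by fun_prop)
  have h01 : Icc (0 : ℝ) 1 ⊆ S := by
    -- Continuous induction along the segment: the bound holds at `0`, is a closed condition, and is
    -- pushed to the right of `t` by `hloc` at `γ t`.
    refine (hS.inter isClosed_Icc).Icc_subset_of_forall_exists_gt (by simp [S, γ]) ?_
    rintro t ⟨htS, ht⟩ t' ht'
    have hev : ∀ᶠ r in 𝓝[>] t, dist (f (γ r)) (f (γ t)) ≤ L * dist (γ r) (γ t) :=
      (hγ.tendsto t).eventually (hloc (γ t)) |>.filter_mono nhdsWithin_le_nhds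
    obtain ⟨r, hr, hrt⟩ := (hev.and (Ioc_mem_nhdsGT ht')).exists
    refine ⟨r, ?_, hrt⟩
    rw [hdist, abs_of_pos (sub_pos.2 hrt.1)] at hr
    have htS' : dist (f (γ t)) (f x) ≤ L * (t * dist x y) := htS
    have := dist_triangle (f (γ r)) (f (γ t)) (f x)
    change dist (f (γ r)) (f x) ≤ L * (r * dist x y)
    linarith
  have := h01 (right_mem_Icc.2 zero_le_one)
  simpa [S, γ, dist_comm x y] using this

/-- The integral of a directional derivative of a compactly supported Lipschitz function vanishes. -/
theorem integral_lineDeriv_eq_zero {d : ℕ} {g : Pt d → ℝ} {L : ℝ≥0} (hg : LipschitzWith L g)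
    (hsupp : HasCompactSupport g) (v : Pt d) : ∫ x, lineDeriv ℝ g x v = 0 := by
  -- Integration by parts against the constant `1`. The formula reverses the direction of
  -- differentiation, hence `-v`.
  have h := (LipschitzWith.const' (α := Pt d) (K := 0) (1 : ℝ)).integral_lineDeriv_mul_eq
    (μ := volume) hg hsupp (-v)
  simpa [lineDeriv] using h.symm

/-- The derivative is bounded by the Lipschitz constant and vanishes off a compact set. -/
theorem lineDeriv_integrable {d : ℕ} {g : Pt d → ℝ} {L : ℝ≥0} (hg : LipschitzWith L g)
    (hsupp : HasCompactSupport g) (v : Pt d) : Integrable (fun x => lineDeriv ℝ g x v) := by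
  have hsub : Function.support (fun x => lineDeriv ℝ g x v) ⊆ tsupport g := by
    intro x hx
    by_contra h
    apply hx
    have h0 : g =ᶠ[𝓝 x] 0 := notMem_tsupport_iff_eventuallyEq.1 h
    change lineDeriv ℝ g x v = 0
    rw [h0.lineDeriv_eq]
    simp [lineDeriv]
  refine (integrableOn_iff_integrable_of_support_subset hsub).1 ?_
  refine Measure.integrableOn_of_bounded (M := L * ‖v‖) hsupp.isCompact.measure_lt_top.ne
    (aestronglyMeasurable_lineDeriv hg.continuous _) ?_
  exact Eventually.of_forall fun x => norm_lineDeriv_le_of_lipschitz ℝ hg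

/-! ### Families of cells -/

/-- A finite family of convex bodies which intersect in null sets. -/
structure IsCellFamily {d : ℕ} {ι : Type*} (s : Finset ι) (C : ι → Set (Pt d)) : Prop where
  isCompact : ∀ i ∈ s, IsCompact (C i)
  convex : ∀ i ∈ s, Convex ℝ (C i)
  nonempty_interior : ∀ i ∈ s, (interior (C i)).Nonempty
  null_inter : ∀ i ∈ s, ∀ j ∈ s, i ≠ j → volume (C i ∩ C j) = 0

/-- `F` agrees on each cell with a function of class `C^n` on the whole space. -/
def PiecewiseContDiff {d : ℕ} {ι : Type*} (n : WithTop ℕ∞) (s : Finset ι) (C : ι → Set (Pt d))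
    {G : Type*} [NormedAddCommGroup G] [NormedSpace ℝ G] (F : Pt d → G) : Prop :=
  ∀ i ∈ s, ∃ q : Pt d → G, ContDiff ℝ n q ∧ EqOn F q (C i)

namespace IsCellFamily

variable {d : ℕ} {ι : Type*} {s : Finset ι} {C : ι → Set (Pt d)}

/-- The frontier of a convex set is null. Classical derivatives in cell interiors thus suffice under
every integral. -/
theorem ae_mem_interior (h : IsCellFamily s C) {i : ι} (hi : i ∈ s) :
    ∀ᵐ x ∂volume.restrict (C i), x ∈ interior (C i) := by
  rw [ae_restrict_iff' (h.isCompact i hi).measurableSet]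
  have := (h.convex i hi).addHaar_frontier volume
  filter_upwards [measure_eq_zero_iff_ae_notMem.1 this] with x hx hxC
  by_contra hx'
  exact hx ⟨subset_closure hxC, hx'⟩

theorem restrict_biUnion (h : IsCellFamily s C) :
    (volume : Measure (Pt d)).restrict (⋃ i ∈ s, C i)
      = ∑ i ∈ s, (volume : Measure (Pt d)).restrict (C i) := by
  classical
  have hd : Pairwise (Function.onFun (AEDisjoint volume) fun i : s => C i) :=
    fun i j hij => h.null_inter i i.2 j j.2 fun h => hij (Subtype.ext h)
  have hU : ⋃ i ∈ s, C i = ⋃ i : s, C i := biUnion_eq_iUnion (s : Set ι) fun i _ => C i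
  rw [hU, Measure.restrict_iUnion_ae hd fun i => (h.isCompact i i.2).nullMeasurableSet,
    Measure.sum_fintype, Finset.sum_coe_sort s (fun i => (volume : Measure (Pt d)).restrict (C i))]

theorem integral_biUnion (h : IsCellFamily s C) {F : Pt d → ℝ}
    (hF : ∀ i ∈ s, IntegrableOn F (C i)) :
    ∫ x in ⋃ i ∈ s, C i, F x = ∑ i ∈ s, ∫ x in C i, F x := by
  rw [h.restrict_biUnion, integral_finsetSum_measure hF]

theorem integrableOn_biUnion (h : IsCellFamily s C) {F : Pt d → ℝ}
    (hF : ∀ i ∈ s, IntegrableOn F (C i)) : IntegrableOn F (⋃ i ∈ s, C i) := by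
  rw [IntegrableOn, h.restrict_biUnion]
  exact integrable_finsetSum_measure.2 hF

theorem ae_biUnion (h : IsCellFamily s C) {p : Pt d → Prop}
    (hp : ∀ i ∈ s, ∀ x ∈ interior (C i), p x) : ∀ᵐ x ∂volume.restrict (⋃ i ∈ s, C i), p x := by
  rw [h.restrict_biUnion, ae_finsetSum_measure_iff]
  intro i hi
  filter_upwards [h.ae_mem_interior hi] with x hx using hp i hi x hx

/-- A function that agrees in the interior of a cell with a continuous function is in `L²`. -/
theorem memLp_of_eqOn_interior (h : IsCellFamily s C) {i : ι} (hi : i ∈ s) {F q : Pt d → ℝ}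
    (hq : ContinuousOn q (C i)) (hFq : EqOn F q (interior (C i))) :
    MemLp F 2 (volume.restrict (C i)) := by
  have hfin : IsFiniteMeasure ((volume : Measure (Pt d)).restrict (C i)) :=
    ⟨by simpa using (h.isCompact i hi).measure_lt_top⟩
  obtain ⟨M, hM⟩ := (h.isCompact i hi).exists_bound_of_continuousOn hq
  have hq2 : MemLp q 2 (volume.restrict (C i)) :=
    MemLp.of_bound (hq.aestronglyMeasurable (h.isCompact i hi).measurableSet) M
      ((ae_restrict_iff' (h.isCompact i hi).measurableSet).2 (Eventually.of_forall hM))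
  refine hq2.ae_eq ?_
  filter_upwards [h.ae_mem_interior hi] with x hx using (hFq hx).symm

theorem isClosed_biUnion (h : IsCellFamily s C) : IsClosed (⋃ i ∈ s, C i) :=
  s.finite_toSet.isClosed_biUnion fun i hi => (h.isCompact i hi).isClosed

theorem isCompact_biUnion (h : IsCellFamily s C) : IsCompact (⋃ i ∈ s, C i) :=
  s.finite_toSet.isCompact_biUnion fun i hi => h.isCompact i hi

/-- The extension by zero of a piecewise `C¹` function which vanishes on the boundary is
Lipschitz. -/
theorem exists_lipschitzWith_indicator (h : IsCellFamily s C) {F : Pt d → ℝ}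
    (hF : PiecewiseContDiff 1 s C F) (h0 : ∀ x ∈ frontier (⋃ i ∈ s, C i), F x = 0) :
    ∃ L : ℝ≥0, LipschitzWith L (indicator (⋃ i ∈ s, C i) F) := by
  classical
  set Ω := ⋃ i ∈ s, C i with hΩ
  have hL : ∀ i ∈ s, ∃ L : ℝ≥0, LipschitzOnWith L F (C i) := by
    intro i hi
    obtain ⟨q, hq, hFq⟩ := hF i hi
    obtain ⟨L, hL⟩ := LocallyLipschitzOn.exists_lipschitzOnWith_of_compact (h.isCompact i hi)
      (hq.locallyLipschitz.locallyLipschitzOn (s := C i))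
    exact ⟨L, fun x hx y hy => by rw [hFq hx, hFq hy]; exact hL hx hy⟩
  choose! L hL using hL
  -- The cells and the closure of the complement of `Ω` cover the space. On that closure the
  -- extension is zero, by `h0` at the points that belong to `Ω`; the sum is a constant valid on all
  -- cells.
  refine ⟨∑ i ∈ s, L i, lipschitzWith_of_finite_closed_cover
    (s := Finset.insertNone s) (C := fun o => o.elim (closure Ωᶜ) C) ?_ ?_ ?_⟩
  · rintro (_ | i) hi
    · exact isClosed_closure
    · exact (h.isCompact i (by simpa using hi)).isClosed
  · intro x
    by_cases hx : x ∈ Ω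
    · obtain ⟨i, hi, hxi⟩ := mem_iUnion₂.1 hx
      exact ⟨some i, by simpa using hi, hxi⟩
    · exact ⟨none, by simp, subset_closure hx⟩
  · rintro (_ | i) hi
    · have : EqOn (indicator Ω F) (fun _ => 0) (closure Ωᶜ) := by
        intro x hx
        by_cases hxΩ : x ∈ Ω
        · rw [indicator_of_mem hxΩ]
          exact h0 x (by rw [frontier_eq_closure_inter_closure]; exact ⟨subset_closure hxΩ, hx⟩)
        · exact indicator_of_notMem hxΩ F
      intro x hx y hy
      rw [this hx, this hy]
      simp
    · have hi' : i ∈ s := by simpa using hi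
      have hle : L i ≤ ∑ i ∈ s, L i := Finset.single_le_sum (fun _ _ => zero_le) hi'
      have hsub : C i ⊆ Ω := subset_biUnion_of_mem (u := C) hi'
      intro x hx y hy
      rw [indicator_of_mem (hsub hx), indicator_of_mem (hsub hy)]
      exact ((hL i hi').weaken hle) hx hy

/-- The divergence theorem for piecewise `C¹` vector fields vanishing on the boundary. -/
theorem integral_divergence_eq_zero (h : IsCellFamily s C) {F : Pt d → Pt d}
    (hF : PiecewiseContDiff 1 s C F) (h0 : ∀ x ∈ frontier (⋃ i ∈ s, C i), F x = 0) :
    ∫ x in ⋃ i ∈ s, C i, divergence F x = 0 := by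
  set Ω := ⋃ i ∈ s, C i with hΩ
  let g : Fin d → Pt d → ℝ := fun j => indicator Ω fun x => F x j
  have hsupp : ∀ j, HasCompactSupport (g j) := fun j =>
    HasCompactSupport.intro h.isCompact_biUnion fun x hx => indicator_of_notMem hx _
  have hlip : ∀ j, ∃ L : ℝ≥0, LipschitzWith L (g j) := by
    intro j
    refine h.exists_lipschitzWith_indicator ?_ fun x hx => by simp [h0 x hx]
    intro i hi
    obtain ⟨q, hq, hFq⟩ := hF i hi
    exact ⟨fun x => q x j, by fun_prop, fun x hx => by simp [hFq hx]⟩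
  choose L hL using hlip
  let e : Fin d → Pt d := fun j => EuclideanSpace.single j 1
  -- In a cell interior both sides are derivatives of the same `C¹` function; cell boundaries, where
  -- they may differ, are null.
  have hin : ∀ᵐ x ∂volume.restrict Ω, divergence F x = ∑ j, lineDeriv ℝ (g j) x (e j) := by
    refine h.ae_biUnion fun i hi x hx => ?_
    obtain ⟨q, hq, hFq⟩ := hF i hi
    have hnhds : interior (C i) ∈ 𝓝 x := isOpen_interior.mem_nhds hx
    have hev : F =ᶠ[𝓝 x] q := by
      filter_upwards [hnhds] with y hy using hFq (interior_subset hy)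
    have hqd : DifferentiableAt ℝ q x := (hq.differentiable one_ne_zero) x
    refine Finset.sum_congr rfl fun j _ => ?_
    have hgj : g j =ᶠ[𝓝 x] fun y => q y j := by
      filter_upwards [hnhds] with y hy
      have : y ∈ Ω := subset_biUnion_of_mem (u := C) hi (interior_subset hy)
      simp [g, indicator_of_mem this, hFq (interior_subset hy)]
    rw [hev.fderiv_eq, hgj.lineDeriv_eq]
    have h1 : HasFDerivAt (fun y => q y j)
        ((EuclideanSpace.proj j : Pt d →L[ℝ] ℝ).comp (fderiv ℝ q x)) x :=
      (EuclideanSpace.proj j : Pt d →L[ℝ] ℝ).hasFDerivAt.comp x hqd.hasFDerivAt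
    rw [(h1.hasLineDerivAt (e j)).lineDeriv]
    simp [e]
  have hout : ∀ x, x ∉ Ω → ∑ j, lineDeriv ℝ (g j) x (e j) = 0 := by
    intro x hx
    refine Finset.sum_eq_zero fun j _ => ?_
    have : g j =ᶠ[𝓝 x] 0 := by
      filter_upwards [h.isClosed_biUnion.isOpen_compl.mem_nhds hx] with y hy
        using indicator_of_notMem hy _
    rw [this.lineDeriv_eq]
    simp [lineDeriv]
  calc ∫ x in Ω, divergence F x = ∫ x in Ω, ∑ j, lineDeriv ℝ (g j) x (e j) :=
        integral_congr_ae hin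
    _ = ∫ x, ∑ j, lineDeriv ℝ (g j) x (e j) := setIntegral_eq_integral_of_forall_compl_eq_zero hout
    _ = ∑ j, ∫ x, lineDeriv ℝ (g j) x (e j) :=
        integral_finsetSum _ fun j _ => lineDeriv_integrable (hL j) (hsupp j) _
    _ = 0 := Finset.sum_eq_zero fun j _ => integral_lineDeriv_eq_zero (hL j) (hsupp j) _

end IsCellFamily

/-! ### The cells of a mesh -/

namespace Mesh

variable {d : ℕ} (T : Mesh d)

theorem mem_cells {K : Finset (Pt d)} : K ∈ T.cells ↔ K ∈ T.faces ∧ K.card = d + 1 := by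
  simp [cells]

theorem domain_eq : T.domain = ⋃ K ∈ T.cells, cell K := by
  ext x
  simp only [domain, Geometry.SimplicialComplex.mem_space_iff, mem_iUnion, exists_prop, mem_cells]
  constructor
  · rintro ⟨t, ht, hx⟩
    obtain ⟨K, hK, htK, hcard⟩ := T.pure t ht
    exact ⟨K, ⟨hK, hcard⟩, convexHull_mono (by exact_mod_cast htK) hx⟩
  · rintro ⟨K, hK, hx⟩
    exact ⟨K, hK.1, hx⟩

theorem cell_subset_domain {K : Finset (Pt d)} (hK : K ∈ T.cells) : cell K ⊆ T.domain := by
  rw [domain_eq]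
  exact subset_biUnion_of_mem (u := fun K => cell K) hK

theorem affineSpan_cell {K : Finset (Pt d)} (hK : K ∈ T.cells) :
    affineSpan ℝ (K : Set (Pt d)) = ⊤ := by
  obtain ⟨hf, hcard⟩ := T.mem_cells.1 hK
  have hi : AffineIndependent ℝ ((↑) : K → Pt d) := T.indep hf
  have h : affineSpan ℝ (range ((↑) : K → Pt d)) = ⊤ :=
    hi.affineSpan_eq_top_iff_card_eq_finrank_add_one.2 (by simp [hcard])
  rwa [Subtype.range_coe_subtype] at h

/-- Two distinct cells meet inside the hull of their common vertices. There are at most `d` of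
these, so they span a proper affine subspace, which is null. -/
theorem isCellFamily : IsCellFamily T.cells cell where
  isCompact K _ := K.finite_toSet.isCompact_convexHull ℝ
  convex K _ := convex_convexHull ℝ _
  nonempty_interior K hK :=
    interior_convexHull_nonempty_iff_affineSpan_eq_top.2 (T.affineSpan_cell hK)
  null_inter K hK K' hK' hne := by
    classical
    obtain ⟨hf, hcard⟩ := T.mem_cells.1 hK
    obtain ⟨hf', hcard'⟩ := T.mem_cells.1 hK'
    have hlt : (K ∩ K').card < d + 1 := by
      rw [← hcard]
      refine Finset.card_lt_card (Finset.inter_subset_left.ssubset_of_ne fun h => hne ?_)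
      exact Finset.eq_of_subset_of_card_le (Finset.inter_eq_left.1 h) (by omega)
    have hspan : affineSpan ℝ ((K ∩ K' : Finset (Pt d)) : Set (Pt d)) ≠ ⊤ := by
      intro htop
      have hne' : (K ∩ K').Nonempty := by
        rw [Finset.nonempty_iff_ne_empty]
        rintro h
        simp [h] at htop
      have hv := direction_affineSpan ℝ ((K ∩ K' : Finset (Pt d)) : Set (Pt d))
      rw [htop, AffineSubspace.direction_top] at hv
      have hle := finrank_vectorSpan_image_finset_le ℝ (id : Pt d → Pt d) (K ∩ K')
        (n := (K ∩ K').card - 1) (by have := hne'.card_pos; omega)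
      rw [Finset.image_id, ← hv] at hle
      have := hne'.card_pos
      simp at hle
      omega
    refine measure_mono_null ?_ (Measure.addHaar_affineSubspace volume _ hspan)
    refine (T.inter_subset_convexHull hf hf').trans ?_
    rw [Finset.coe_inter]
    exact convexHull_subset_affineSpan _

end Mesh

/-! ### Cellwise affine maps -/

/-- A kernel vector of the linear part would move an interior point of `S` within `S` without
changing its image. -/
theorem bijective_of_injOn {d : ℕ} {g : Pt d →ᵃ[ℝ] Pt d} {S : Set (Pt d)}
    (hS : (interior S).Nonempty) (hg : InjOn g S) : Function.Bijective g := by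
  rw [← AffineMap.linear_bijective_iff]
  have hinj : Function.Injective g.linear := by
    rw [injective_iff_map_eq_zero]
    intro v hv
    obtain ⟨x, hx⟩ := hS
    have hcont : Tendsto (fun t : ℝ => x + t • v) (𝓝 0) (𝓝 x) := by
      have : Continuous fun t : ℝ => x + t • v := by fun_prop
      simpa using this.tendsto 0
    have hev : ∀ᶠ t in 𝓝[≠] (0 : ℝ), x + t • v ∈ interior S :=
      (hcont.eventually (isOpen_interior.mem_nhds hx)).filter_mono nhdsWithin_le_nhds
    obtain ⟨t, ht, ht0⟩ := (hev.and self_mem_nhdsWithin).exists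
    have heq : g (x + t • v) = g x := by
      rw [add_comm, ← vadd_eq_add, g.map_vadd]
      simp [hv]
    have := hg (interior_subset ht) (interior_subset hx) heq
    have h0 : t • v = 0 := by simpa using this
    exact (smul_eq_zero.1 h0).resolve_left ht0
  exact ⟨hinj, LinearMap.injective_iff_surjective.1 hinj⟩

theorem contDiff_affineMap {d : ℕ} (g : Pt d →ᵃ[ℝ] Pt d) {n : WithTop ℕ∞} : ContDiff ℝ n g :=
  ContinuousAffineMap.contDiff (⟨g, g.continuous_of_finiteDimensional⟩ : Pt d →ᴬ[ℝ] Pt d)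

theorem hasFDerivAt_affineMap {d : ℕ} (g : Pt d →ᵃ[ℝ] Pt d) (x : Pt d) :
    HasFDerivAt g (LinearMap.toContinuousLinearMap g.linear) x := by
  have h : (g : Pt d → Pt d) = fun y => LinearMap.toContinuousLinearMap g.linear y + g 0 := by
    rw [g.decomp]
    ext y
    simp
  rw [h]
  exact (ContinuousLinearMap.hasFDerivAt _).add_const _

/-- The map `a` is injective on the domain and affine on each cell. -/
structure IsCellwiseAffine {d : ℕ} (T : Mesh d) (a : Pt d → Pt d) : Prop where
  affine : ∀ K ∈ T.cells, ∃ g : Pt d →ᵃ[ℝ] Pt d, EqOn a g (cell K)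
  injOn : InjOn a T.domain

namespace IsCellwiseAffine

variable {d : ℕ} {T : Mesh d} {a : Pt d → Pt d}

theorem bijective (ha : IsCellwiseAffine T a) {K : Finset (Pt d)} (hK : K ∈ T.cells)
    {g : Pt d →ᵃ[ℝ] Pt d} (hg : EqOn a g (cell K)) : Function.Bijective g :=
  bijective_of_injOn (T.isCellFamily.nonempty_interior K hK)
    (hg.injOn_iff.1 (ha.injOn.mono (T.cell_subset_domain hK)))

theorem exists_affineEquiv (ha : IsCellwiseAffine T a) {K : Finset (Pt d)} (hK : K ∈ T.cells) :
    ∃ e : Pt d ≃ᵃ[ℝ] Pt d, EqOn a e (cell K) := by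
  obtain ⟨g, hg⟩ := ha.affine K hK
  exact ⟨AffineEquiv.ofBijective (ha.bijective hK hg), hg⟩

/-- Convexity, compactness and interior pass through the affine equivalence on each cell.
Injectivity on the whole domain makes the intersection of moved cells the image of the intersection,
hence null. -/
theorem isCellFamily (ha : IsCellwiseAffine T a) :
    IsCellFamily T.cells fun K => a '' cell K where
  isCompact K hK := by
    obtain ⟨e, he⟩ := ha.exists_affineEquiv hK
    rw [he.image_eq]
    exact (T.isCellFamily.isCompact K hK).image
      (e : Pt d →ᵃ[ℝ] Pt d).continuous_of_finiteDimensional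
  convex K hK := by
    obtain ⟨e, he⟩ := ha.exists_affineEquiv hK
    rw [he.image_eq]
    exact (T.isCellFamily.convex K hK).affine_image (e : Pt d →ᵃ[ℝ] Pt d)
  nonempty_interior K hK := by
    obtain ⟨e, he⟩ := ha.exists_affineEquiv hK
    rw [he.image_eq]
    have := (AffineEquiv.toContinuousAffineEquiv e).toHomeomorph.image_interior (cell K)
    change (interior (AffineEquiv.toContinuousAffineEquiv e '' cell K)).Nonempty
    erw [← this]
    exact (T.isCellFamily.nonempty_interior K hK).image _
  null_inter K hK K' hK' hne := by
    obtain ⟨e, he⟩ := ha.exists_affineEquiv hK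
    rw [← ha.injOn.image_inter (T.cell_subset_domain hK) (T.cell_subset_domain hK'),
      (he.mono inter_subset_left).image_eq]
    exact addHaar_image_eq_zero_of_differentiableOn_of_addHaar_eq_zero volume
      ((contDiff_affineMap (e : Pt d →ᵃ[ℝ] Pt d)).differentiable one_ne_zero).differentiableOn
      (T.isCellFamily.null_inter K hK K' hK' hne)

theorem image_domain (_ha : IsCellwiseAffine T a) :
    a '' T.domain = ⋃ K ∈ T.cells, a '' cell K := by
  rw [T.domain_eq, image_iUnion₂]

theorem eulerian_apply (ha : IsCellwiseAffine T a) {G : Type*} (v : Pt d → G) {y : Pt d}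
    (hy : y ∈ T.domain) : eulerian T a v (a y) = v y := by
  rw [eulerian, ha.injOn.leftInvOn_invFunOn hy]

theorem eulerian_eqOn (ha : IsCellwiseAffine T a) {G : Type*} {v q : Pt d → G}
    {K : Finset (Pt d)} (hK : K ∈ T.cells) (hv : EqOn v q (cell K)) {e : Pt d ≃ᵃ[ℝ] Pt d}
    (he : EqOn a e (cell K)) : EqOn (eulerian T a v) (q ∘ e.symm) (a '' cell K) := by
  rintro _ ⟨y, hy, rfl⟩
  rw [ha.eulerian_apply v (T.cell_subset_domain hK hy), hv hy, he hy]
  simp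

theorem piecewiseContDiff_eulerian (ha : IsCellwiseAffine T a) {G : Type*} [NormedAddCommGroup G]
    [NormedSpace ℝ G] {n : WithTop ℕ∞} {v : Pt d → G} (hv : PiecewiseContDiff n T.cells cell v) :
    PiecewiseContDiff n T.cells (fun K => a '' cell K) (eulerian T a v) := by
  intro K hK
  obtain ⟨e, he⟩ := ha.exists_affineEquiv hK
  obtain ⟨q, hq, hvq⟩ := hv K hK
  exact ⟨q ∘ e.symm, hq.comp (contDiff_affineMap (e.symm : Pt d →ᵃ[ℝ] Pt d)),
    ha.eulerian_eqOn hK hvq he⟩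

/-- Change of variables on a cell. -/
theorem integral_image_cell (ha : IsCellwiseAffine T a) {K : Finset (Pt d)} (hK : K ∈ T.cells)
    {g : Pt d →ᵃ[ℝ] Pt d} (hg : EqOn a g (cell K)) (F : Pt d → ℝ) :
    ∫ x in a '' cell K, F x = |LinearMap.det g.linear| * ∫ y in cell K, F (a y) := by
  have hms := (T.isCellFamily.isCompact K hK).measurableSet
  rw [hg.image_eq, integral_image_eq_integral_abs_det_fderiv_smul volume hms
    (fun y _ => (hasFDerivAt_affineMap g y).hasFDerivWithinAt)
    (ha.bijective hK hg).injective.injOn, ← integral_const_mul]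
  refine setIntegral_congr_fun hms fun y hy => ?_
  simp [hg hy, LinearMap.det_toContinuousLinearMap]

theorem volume_image_cell (ha : IsCellwiseAffine T a) {K : Finset (Pt d)} (hK : K ∈ T.cells)
    {g : Pt d →ᵃ[ℝ] Pt d} (hg : EqOn a g (cell K)) :
    volume.real (a '' cell K) = |LinearMap.det g.linear| * volume.real (cell K) := by
  simpa using ha.integral_image_cell hK hg fun _ => 1

end IsCellwiseAffine

/-! ### The discrete ALE motion -/

theorem gridTime_succ (Δt : ℝ) (n : ℕ) : gridTime Δt (n + 1) = gridTime Δt n + Δt := by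
  simp only [gridTime]
  push_cast
  ring

theorem aleMap_gridTime {d : ℕ} {Δt : ℝ} (hΔt : 0 < Δt) (A : ℝ → Pt d → Pt d) (n : ℕ) :
    aleMap Δt A n (gridTime Δt n) = A (gridTime Δt n) := by
  funext Y
  simp [aleMap, gridTime_succ, hΔt.ne']

theorem aleMap_gridTime_succ {d : ℕ} {Δt : ℝ} (hΔt : 0 < Δt) (A : ℝ → Pt d → Pt d) (n : ℕ) :
    aleMap Δt A n (gridTime Δt (n + 1)) = A (gridTime Δt (n + 1)) := by
  funext Y
  simp [aleMap, gridTime_succ, hΔt.ne']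

theorem midMap_eq {d : ℕ} {Δt : ℝ} (hΔt : 0 < Δt) (A : ℝ → Pt d → Pt d) (n : ℕ) (Y : Pt d) :
    midMap Δt A n Y
      = (1 / 2 : ℝ) • A (gridTime Δt (n + 1)) Y + (1 / 2 : ℝ) • A (gridTime Δt n) Y := by
  have h1 : (midTime Δt n - gridTime Δt n) / Δt = 1 / 2 := by
    rw [midTime]
    field_simp
    ring
  have h2 : (gridTime Δt (n + 1) - midTime Δt n) / Δt = 1 / 2 := by
    rw [midTime, gridTime_succ]
    field_simp
    ring
  rw [midMap, aleMap, h1, h2]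

theorem midTime_mem_Icc {Δt : ℝ} (hΔt : 0 < Δt) (n : ℕ) :
    midTime Δt n ∈ Icc (gridTime Δt n) (gridTime Δt (n + 1)) := by
  rw [midTime, gridTime_succ]
  constructor <;> linarith

theorem Icc_gridTime_subset {Δt : ℝ} (hΔt : 0 < Δt) {n N : ℕ} (hn : n ≤ N) :
    Icc (gridTime Δt n) (gridTime Δt (n + 1)) ⊆ Icc 0 (gridTime Δt (N + 1)) := by
  refine Icc_subset_Icc (by unfold gridTime; positivity) ?_
  unfold gridTime
  gcongr

namespace IsALEMotion

variable {d : ℕ} {T : Mesh d} {Δt : ℝ} {N : ℕ} {A : ℝ → Pt d → Pt d}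

theorem isCellwiseAffine (hA : IsALEMotion T Δt N A) {n : ℕ} (hn : n ≤ N) {τ : ℝ}
    (hτ : τ ∈ Icc (gridTime Δt n) (gridTime Δt (n + 1))) :
    IsCellwiseAffine T (aleMap Δt A n τ) where
  injOn := hA.injOn n hn τ hτ
  affine K hK := by
    obtain ⟨g0, h0⟩ := hA.affine n (by omega) K hK
    obtain ⟨g1, h1⟩ := hA.affine (n + 1) (by omega) K hK
    exact ⟨((τ - gridTime Δt n) / Δt) • g1 + ((gridTime Δt (n + 1) - τ) / Δt) • g0,
      fun Y hY => by simp [aleMap, h0 hY, h1 hY]⟩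

theorem isCellwiseAffine_midMap (hA : IsALEMotion T Δt N A) (hΔt : 0 < Δt) {n : ℕ} (hn : n ≤ N) :
    IsCellwiseAffine T (midMap Δt A n) :=
  hA.isCellwiseAffine hn (midTime_mem_Icc hΔt n)

theorem isCellwiseAffine_grid (hA : IsALEMotion T Δt N A) (hΔt : 0 < Δt) {n : ℕ} (hn : n ≤ N) :
    IsCellwiseAffine T (A (gridTime Δt n)) := by
  rw [← aleMap_gridTime hΔt A]
  exact hA.isCellwiseAffine hn (left_mem_Icc.2 (by rw [gridTime_succ]; linarith))

theorem isCellwiseAffine_grid_succ (hA : IsALEMotion T Δt N A) (hΔt : 0 < Δt) {n : ℕ}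
    (hn : n ≤ N) : IsCellwiseAffine T (A (gridTime Δt (n + 1))) := by
  rw [← aleMap_gridTime_succ hΔt A]
  exact hA.isCellwiseAffine hn (right_mem_Icc.2 (by rw [gridTime_succ]; linarith))

theorem piecewiseContDiff_refVelocity (hA : IsALEMotion T Δt N A) {n : ℕ} (hn : n ≤ N)
    {k : WithTop ℕ∞} : PiecewiseContDiff k T.cells cell (refVelocity Δt A n) := by
  intro K hK
  obtain ⟨g0, h0⟩ := hA.affine n (by omega) K hK
  obtain ⟨g1, h1⟩ := hA.affine (n + 1) (by omega) K hK
  exact ⟨_, contDiff_affineMap ((1 / Δt) • (g1 - g0)),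
    fun Y hY => by simp [refVelocity, h0 hY, h1 hY]⟩

theorem piecewiseContDiff_meshVelocity (hA : IsALEMotion T Δt N A) (hΔt : 0 < Δt) {n : ℕ}
    (hn : n ≤ N) {k : WithTop ℕ∞} :
    PiecewiseContDiff k T.cells (midCell Δt A n) (meshVelocity T Δt A n) :=
  (hA.isCellwiseAffine_midMap hΔt hn).piecewiseContDiff_eulerian
    (hA.piecewiseContDiff_refVelocity hn)

end IsALEMotion

/-! ### Jacobians of the motion and the geometric conservation law. -/

theorem divergence_affineMap {d : ℕ} (g : Pt d →ᵃ[ℝ] Pt d) (x : Pt d) :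
    divergence g x = LinearMap.trace ℝ (Pt d) g.linear := by
  rw [divergence, (hasFDerivAt_affineMap g x).fderiv,
    LinearMap.trace_eq_matrix_trace ℝ (EuclideanSpace.basisFun (Fin d) ℝ).toBasis, Matrix.trace]
  refine Finset.sum_congr rfl fun i _ => ?_
  simp [LinearMap.toMatrix_apply]

/-- The determinant is an affine or quadratic function on `ℝ^d`, `d ≤ 2`, so that the midpoint rule
integrates its derivative exactly. -/
theorem det_one_add_sub_det_one_sub {d : ℕ} (hd : d = 1 ∨ d = 2) (X : Pt d →ₗ[ℝ] Pt d) :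
    LinearMap.det (1 + (1 / 2 : ℝ) • X) - LinearMap.det (1 - (1 / 2 : ℝ) • X)
      = LinearMap.trace ℝ (Pt d) X := by
  let B := (EuclideanSpace.basisFun (Fin d) ℝ).toBasis
  rw [← LinearMap.det_toMatrix B, ← LinearMap.det_toMatrix B,
    LinearMap.trace_eq_matrix_trace ℝ B, map_add, map_sub, map_smul, LinearMap.toMatrix_one]
  generalize LinearMap.toMatrix B B X = Y
  clear_value B
  rcases hd with rfl | rfl
  · simp [Matrix.trace]
    ring
  · simp [Matrix.det_fin_two, Matrix.trace]
    ring

theorem continuous_linearMap_det {d : ℕ} (L₀ L₁ : Pt d →ₗ[ℝ] Pt d) :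
    Continuous fun θ : ℝ => LinearMap.det (θ • L₁ + (1 - θ) • L₀) := by
  let B := (EuclideanSpace.basisFun (Fin d) ℝ).toBasis
  have h : (fun θ : ℝ => LinearMap.det (θ • L₁ + (1 - θ) • L₀)) = fun θ : ℝ =>
      (θ • LinearMap.toMatrix B B L₁ + (1 - θ) • LinearMap.toMatrix B B L₀).det := by
    funext θ
    rw [← LinearMap.det_toMatrix B, map_add, map_smul, map_smul]
  rw [h]
  exact Continuous.matrix_det (by fun_prop)

theorem pos_or_neg_of_continuous {φ : ℝ → ℝ} (hφ : Continuous φ)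
    (h0 : ∀ θ ∈ Icc (0 : ℝ) 1, φ θ ≠ 0) :
    (∀ θ ∈ Icc (0 : ℝ) 1, 0 < φ θ) ∨ ∀ θ ∈ Icc (0 : ℝ) 1, φ θ < 0 := by
  by_contra! h
  obtain ⟨⟨a, ha, hφa⟩, b, hb, hφb⟩ := h
  obtain ⟨θ, hθ, hφθ⟩ := isPreconnected_Icc.intermediate_value ha hb hφ.continuousOn ⟨hφa, hφb⟩
  exact h0 θ hθ hφθ

namespace IsALEMotion

variable {d : ℕ} {T : Mesh d} {Δt : ℝ} {N : ℕ} {A : ℝ → Pt d → Pt d}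

/-- On a cell the divergence of the mesh velocity is the trace of the affine velocity gradient. -/
theorem divergence_meshVelocity (hA : IsALEMotion T Δt N A) (hΔt : 0 < Δt) {n : ℕ} (hn : n ≤ N)
    {K : Finset (Pt d)} (hK : K ∈ T.cells) {g₀ g₁ : Pt d →ᵃ[ℝ] Pt d}
    (h₀ : EqOn (A (gridTime Δt n)) g₀ (cell K))
    (h₁ : EqOn (A (gridTime Δt (n + 1))) g₁ (cell K)) {e : Pt d ≃ᵃ[ℝ] Pt d}
    (he : EqOn (midMap Δt A n) e (cell K)) :
    EqOn (divergence (meshVelocity T Δt A n))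
      (fun _ => LinearMap.trace ℝ (Pt d)
        (((1 / Δt) • (g₁.linear - g₀.linear)) ∘ₗ (e.symm.linear : Pt d →ₗ[ℝ] Pt d)))
      (interior (midCell Δt A n K)) := by
  intro x hx
  have hr : EqOn (refVelocity Δt A n) ((1 / Δt) • (g₁ - g₀)) (cell K) :=
    fun Y hY => by simp [refVelocity, h₀ hY, h₁ hY]
  have heq := (hA.isCellwiseAffine_midMap hΔt hn).eulerian_eqOn hK hr he
  have hev : meshVelocity T Δt A n =ᶠ[𝓝 x]
      (((1 / Δt) • (g₁ - g₀)).comp (e.symm : Pt d →ᵃ[ℝ] Pt d) : Pt d →ᵃ[ℝ] Pt d) := by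
    filter_upwards [isOpen_interior.mem_nhds hx] with y hy using heq (interior_subset hy)
  have : divergence (meshVelocity T Δt A n) x = divergence
      (((1 / Δt) • (g₁ - g₀)).comp (e.symm : Pt d →ᵃ[ℝ] Pt d) : Pt d →ᵃ[ℝ] Pt d) x := by
    simp only [divergence, hev.fderiv_eq]
  rw [this, divergence_affineMap]
  rfl

/-- In dimensions one and two the geometric conservation law is automatic. -/
theorem gcl (hA : IsALEMotion T Δt N A) (hΔt : 0 < Δt) (hd : d = 1 ∨ d = 2) : GCL T Δt N A := by
  intro n hn K hK
  have hm := hA.isCellwiseAffine_midMap hΔt hn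
  obtain ⟨g₀, h₀⟩ := hA.affine n (by omega) K hK
  obtain ⟨g₁, h₁⟩ := hA.affine (n + 1) (by omega) K hK
  let g : Pt d →ᵃ[ℝ] Pt d := (1 / 2 : ℝ) • g₁ + (1 / 2 : ℝ) • g₀
  have hg : EqOn (midMap Δt A n) g (cell K) := fun Y hY => by
    simp [midMap_eq hΔt, g, h₀ hY, h₁ hY]
  let e : Pt d ≃ᵃ[ℝ] Pt d := AffineEquiv.ofBijective (hm.bijective hK hg)
  have he : EqOn (midMap Δt A n) e (cell K) := hg
  -- `Δt` times the gradient of the mesh velocity in midpoint coordinates. As `g` is the mean of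
  -- `g₀` and `g₁`, the linear parts of `g₁` and `g₀` are `1 + X/2` and `1 - X/2` composed with that
  -- of `g`.
  let X : Pt d →ₗ[ℝ] Pt d := (g₁.linear - g₀.linear) ∘ₗ (e.symm.linear : Pt d →ₗ[ℝ] Pt d)
  have hXe : X ∘ₗ g.linear = g₁.linear - g₀.linear := by
    ext1 v
    change (g₁.linear - g₀.linear) (e.linear.symm (e.linear v)) = _
    rw [LinearEquiv.symm_apply_apply]
  have hdet₁ : LinearMap.det g₁.linear
      = LinearMap.det (1 + (1 / 2 : ℝ) • X) * LinearMap.det g.linear := by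
    rw [← LinearMap.det_comp, LinearMap.add_comp, LinearMap.smul_comp, hXe]
    congr 1
    ext1 v
    simp only [g, AffineMap.add_linear, AffineMap.smul_linear, LinearMap.add_apply,
      LinearMap.comp_apply, LinearMap.smul_apply, LinearMap.sub_apply, Module.End.one_apply]
    module
  have hdet₀ : LinearMap.det g₀.linear
      = LinearMap.det (1 - (1 / 2 : ℝ) • X) * LinearMap.det g.linear := by
    rw [← LinearMap.det_comp, LinearMap.sub_comp, LinearMap.smul_comp, hXe]
    congr 1
    ext1 v
    simp only [g, AffineMap.add_linear, AffineMap.smul_linear, LinearMap.add_apply,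
      LinearMap.comp_apply, LinearMap.smul_apply, LinearMap.sub_apply, Module.End.one_apply]
    module
  have hdiff : LinearMap.det g₁.linear - LinearMap.det g₀.linear
      = LinearMap.trace ℝ (Pt d) X * LinearMap.det g.linear := by
    rw [hdet₁, hdet₀, ← sub_mul, det_one_add_sub_det_one_sub hd]
  -- The Jacobian at time `t^n + θ Δt`. Injectivity at every intermediate time keeps it away from
  -- zero, so it has one sign and `hdiff` carries over to the absolute values that measure volume.
  let φ : ℝ → ℝ := fun θ => LinearMap.det (θ • g₁.linear + (1 - θ) • g₀.linear)
  have hφ0 : ∀ θ ∈ Icc (0 : ℝ) 1, φ θ ≠ 0 := by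
    intro θ hθ
    let gθ : Pt d →ᵃ[ℝ] Pt d := θ • g₁ + (1 - θ) • g₀
    have hτ : gridTime Δt n + θ * Δt ∈ Icc (gridTime Δt n) (gridTime Δt (n + 1)) := by
      rw [gridTime_succ]
      constructor <;> nlinarith [hθ.1, hθ.2]
    have hgθ : EqOn (aleMap Δt A n (gridTime Δt n + θ * Δt)) gθ (cell K) := fun Y hY => by
      have e1 : (gridTime Δt n + θ * Δt - gridTime Δt n) / Δt = θ := by field_simp; ring
      have e2 : (gridTime Δt (n + 1) - (gridTime Δt n + θ * Δt)) / Δt = 1 - θ := by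
        rw [gridTime_succ]; field_simp; ring
      simp only [aleMap, h₀ hY, h₁ hY, e1, e2]
      rfl
    have hbij := (AffineMap.linear_bijective_iff gθ).2
      ((hA.isCellwiseAffine hn hτ).bijective hK hgθ)
    exact (LinearEquiv.isUnit_det' (LinearEquiv.ofBijective gθ.linear hbij)).ne_zero
  have hφ1 : φ 1 = LinearMap.det g₁.linear := by simp [φ]
  have hφ00 : φ 0 = LinearMap.det g₀.linear := by simp [φ]
  have hφm : φ (1 / 2) = LinearMap.det g.linear := by
    simp only [φ, g, AffineMap.add_linear, AffineMap.smul_linear]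
    norm_num
  have habs : |LinearMap.det g₁.linear| - |LinearMap.det g₀.linear|
      = LinearMap.trace ℝ (Pt d) X * |LinearMap.det g.linear| := by
    have m0 : (0 : ℝ) ∈ Icc (0 : ℝ) 1 := by simp
    have m1 : (1 : ℝ) ∈ Icc (0 : ℝ) 1 := by simp
    have mh : (1 / 2 : ℝ) ∈ Icc (0 : ℝ) 1 := by constructor <;> norm_num
    rw [← hφ1, ← hφ00, ← hφm] at hdiff ⊢
    rcases pos_or_neg_of_continuous (φ := φ)
      (continuous_linearMap_det g₀.linear g₁.linear) hφ0 with h | h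
    · rw [abs_of_pos (h 1 m1), abs_of_pos (h 0 m0), abs_of_pos (h _ mh)]
      exact hdiff
    · rw [abs_of_neg (h 1 m1), abs_of_neg (h 0 m0), abs_of_neg (h _ mh)]
      linear_combination -hdiff
  have hint : ∫ x in midCell Δt A n K, divergence (meshVelocity T Δt A n) x
      = 1 / Δt * LinearMap.trace ℝ (Pt d) X * volume.real (midCell Δt A n K) := by
    have hae : ∀ᵐ x ∂volume.restrict (midCell Δt A n K), divergence (meshVelocity T Δt A n) x
        = 1 / Δt * LinearMap.trace ℝ (Pt d) X := by
      filter_upwards [hm.isCellFamily.ae_mem_interior hK] with x hx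
      rw [hA.divergence_meshVelocity hΔt hn hK h₀ h₁ he hx, LinearMap.smul_comp, map_smul,
        smul_eq_mul]
    rw [integral_congr_ae hae]
    simp [mul_comm]
  rw [hint, gridCell, gridCell, midCell,
    (hA.isCellwiseAffine_grid_succ hΔt hn).volume_image_cell hK h₁,
    (hA.isCellwiseAffine_grid hΔt hn).volume_image_cell hK h₀, hm.volume_image_cell hK hg,
    ← sub_mul, habs]
  field_simp

/-- The change of the integral of a function that is transported with a cell. -/
theorem integral_gridCell_sub (hA : IsALEMotion T Δt N A) (hΔt : 0 < Δt) (hG : GCL T Δt N A)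
    {n : ℕ} (hn : n ≤ N) {K : Finset (Pt d)} (hK : K ∈ T.cells) (F : Pt d → ℝ) :
    (∫ x in gridCell Δt A (n + 1) K, eulerian T (A (gridTime Δt (n + 1))) F x)
        - ∫ x in gridCell Δt A n K, eulerian T (A (gridTime Δt n)) F x
      = Δt * ∫ x in midCell Δt A n K,
          eulerian T (midMap Δt A n) F x * divergence (meshVelocity T Δt A n) x := by
  have hm := hA.isCellwiseAffine_midMap hΔt hn
  have ha₀ := hA.isCellwiseAffine_grid hΔt hn
  have ha₁ := hA.isCellwiseAffine_grid_succ hΔt hn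
  obtain ⟨g₀, h₀⟩ := hA.affine n (by omega) K hK
  obtain ⟨g₁, h₁⟩ := hA.affine (n + 1) (by omega) K hK
  obtain ⟨e, he⟩ := hm.exists_affineEquiv hK
  have hae : ∀ᵐ x ∂volume.restrict (midCell Δt A n K), divergence (meshVelocity T Δt A n) x
      = LinearMap.trace ℝ (Pt d)
        (((1 / Δt) • (g₁.linear - g₀.linear)) ∘ₗ (e.symm.linear : Pt d →ₗ[ℝ] Pt d)) := by
    filter_upwards [hm.isCellFamily.ae_mem_interior hK] with x hx using
      hA.divergence_meshVelocity hΔt hn hK h₀ h₁ he hx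
  generalize LinearMap.trace ℝ (Pt d)
        (((1 / Δt) • (g₁.linear - g₀.linear)) ∘ₗ (e.symm.linear : Pt d →ₗ[ℝ] Pt d)) = D at hae
  have he' : EqOn (midMap Δt A n) (e : Pt d →ᵃ[ℝ] Pt d) (cell K) := he
  have hvol := hG n hn K hK
  have hD : ∫ x in midCell Δt A n K, divergence (meshVelocity T Δt A n) x
      = D * volume.real (midCell Δt A n K) := by
    rw [integral_congr_ae hae]
    simp [mul_comm]
  have hFD : ∫ x in midCell Δt A n K,
        eulerian T (midMap Δt A n) F x * divergence (meshVelocity T Δt A n) x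
      = (∫ x in midCell Δt A n K, eulerian T (midMap Δt A n) F x) * D := by
    rw [← integral_mul_const]
    refine integral_congr_ae ?_
    filter_upwards [hae] with x hx
    rw [hx]
  have hpull : ∀ {a : Pt d → Pt d} (_ : IsCellwiseAffine T a),
      ∫ y in cell K, eulerian T a F (a y) = ∫ y in cell K, F y := fun ha =>
    setIntegral_congr_fun (T.isCellFamily.isCompact K hK).measurableSet fun y hy =>
      ha.eulerian_apply F (T.cell_subset_domain hK hy)
  rw [hD, gridCell, gridCell, midCell, ha₁.volume_image_cell hK h₁, ha₀.volume_image_cell hK h₀,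
    hm.volume_image_cell hK he'] at hvol
  have hpos : 0 < volume.real (cell K) := by
    refine ENNReal.toReal_pos ?_ (T.isCellFamily.isCompact K hK).measure_lt_top.ne
    exact (Measure.measure_pos_of_nonempty_interior volume
      (T.isCellFamily.nonempty_interior K hK)).ne'
  rw [hFD, gridCell, gridCell, midCell, ha₁.integral_image_cell hK h₁,
    ha₀.integral_image_cell hK h₀, hm.integral_image_cell hK he', hpull ha₁, hpull ha₀, hpull hm]
  -- Dividing the conservation law by the positive volume of the reference cell leaves a relation
  -- between Jacobians alone, which can then be multiplied by the integral of any `F`.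
  have key : |LinearMap.det g₁.linear| - |LinearMap.det g₀.linear|
      = Δt * D * |LinearMap.det (e : Pt d →ᵃ[ℝ] Pt d).linear| :=
    mul_right_cancel₀ hpos.ne' (by linear_combination hvol)
  linear_combination (∫ y in cell K, F y) * key

end IsALEMotion

/-! ### Piecewise continuous functions -/

/-- `F` agrees in the interior of each cell with a function that is continuous everywhere. -/
def PiecewiseContinuous {d : ℕ} {ι : Type*} (s : Finset ι) (C : ι → Set (Pt d)) {G : Type*}
    [TopologicalSpace G] (F : Pt d → G) : Prop :=
  ∀ i ∈ s, ∃ q : Pt d → G, Continuous q ∧ EqOn F q (interior (C i))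

theorem continuous_gradient {d : ℕ} {q : Pt d → ℝ} (hq : ContDiff ℝ 1 q) :
    Continuous (gradient q) :=
  (InnerProductSpace.toDual ℝ (Pt d)).symm.continuous.comp (hq.continuous_fderiv one_ne_zero)

theorem continuous_laplacian {d : ℕ} {q : Pt d → ℝ} (hq : ContDiff ℝ 2 q) :
    Continuous (Laplacian.laplacian q) := by
  rw [InnerProductSpace.laplacian_eq_iteratedFDeriv_stdOrthonormalBasis]
  refine continuous_finsetSum _ fun i _ => ?_
  exact (ContinuousMultilinearMap.apply ℝ (fun _ : Fin 2 => Pt d) ℝ _).continuous.comp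
    (hq.continuous_iteratedFDeriv (m := 2) le_rfl)

theorem continuous_divergence {d : ℕ} {q : Pt d → Pt d} (hq : ContDiff ℝ 1 q) :
    Continuous (divergence q) := by
  unfold divergence
  have := hq.continuous_fderiv one_ne_zero
  fun_prop

section Piecewise

variable {d : ℕ} {ι : Type*} {s : Finset ι} {C : ι → Set (Pt d)}

theorem _root_.Continuous.piecewiseContinuous {G : Type*} [TopologicalSpace G] {F : Pt d → G}
    (hF : Continuous F) : PiecewiseContinuous s C F :=
  fun _ _ => ⟨F, hF, fun _ _ => rfl⟩

theorem PiecewiseContinuous.comp₂ {G H R : Type*} [TopologicalSpace G] [TopologicalSpace H]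
    [TopologicalSpace R] {F : Pt d → G} {F' : Pt d → H} (hF : PiecewiseContinuous s C F)
    (hF' : PiecewiseContinuous s C F') {Φ : G → H → R} (hΦ : Continuous (Function.uncurry Φ)) :
    PiecewiseContinuous s C fun x => Φ (F x) (F' x) := by
  intro i hi
  obtain ⟨q, hq, h⟩ := hF i hi
  obtain ⟨q', hq', h'⟩ := hF' i hi
  exact ⟨fun x => Φ (q x) (q' x), hΦ.comp (hq.prodMk hq'), fun x hx => by simp [h hx, h' hx]⟩

theorem PiecewiseContinuous.mul {F F' : Pt d → ℝ} (hF : PiecewiseContinuous s C F)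
    (hF' : PiecewiseContinuous s C F') : PiecewiseContinuous s C fun x => F x * F' x :=
  hF.comp₂ hF' (Φ := fun a b => a * b) continuous_mul

theorem PiecewiseContinuous.add {F F' : Pt d → ℝ} (hF : PiecewiseContinuous s C F)
    (hF' : PiecewiseContinuous s C F') : PiecewiseContinuous s C fun x => F x + F' x :=
  hF.comp₂ hF' (Φ := fun a b => a + b) continuous_add

theorem PiecewiseContinuous.sub {G : Type*} [NormedAddCommGroup G] {F F' : Pt d → G}
    (hF : PiecewiseContinuous s C F) (hF' : PiecewiseContinuous s C F') :
    PiecewiseContinuous s C fun x => F x - F' x :=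
  hF.comp₂ hF' (Φ := fun a b => a - b) continuous_sub

theorem PiecewiseContinuous.inner {F F' : Pt d → Pt d} (hF : PiecewiseContinuous s C F)
    (hF' : PiecewiseContinuous s C F') : PiecewiseContinuous s C fun x => ⟪F x, F' x⟫ :=
  hF.comp₂ hF' (Φ := fun a b => ⟪a, b⟫) continuous_inner

theorem PiecewiseContDiff.of_le {G : Type*} [NormedAddCommGroup G] [NormedSpace ℝ G]
    {m n : WithTop ℕ∞} {F : Pt d → G} (hF : PiecewiseContDiff n s C F) (h : m ≤ n) :
    PiecewiseContDiff m s C F := fun i hi =>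
  let ⟨q, hq, hFq⟩ := hF i hi
  ⟨q, hq.of_le h, hFq⟩

theorem PiecewiseContDiff.continuous {G : Type*} [NormedAddCommGroup G] [NormedSpace ℝ G]
    {n : WithTop ℕ∞} {F : Pt d → G} (hF : PiecewiseContDiff n s C F) :
    PiecewiseContinuous s C F := fun i hi =>
  let ⟨q, hq, hFq⟩ := hF i hi
  ⟨q, hq.continuous, hFq.mono interior_subset⟩

theorem PiecewiseContDiff.smul {n : WithTop ℕ∞} {U : Pt d → ℝ} {F : Pt d → Pt d}
    (hU : PiecewiseContDiff n s C U) (hF : PiecewiseContDiff n s C F) :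
    PiecewiseContDiff n s C fun x => U x • F x := by
  intro i hi
  obtain ⟨q, hq, h⟩ := hU i hi
  obtain ⟨q', hq', h'⟩ := hF i hi
  exact ⟨fun x => q x • q' x, hq.smul hq', fun x hx => by simp [h hx, h' hx]⟩

theorem PiecewiseContDiff.eventuallyEq {G : Type*} [NormedAddCommGroup G] [NormedSpace ℝ G]
    {n : WithTop ℕ∞} {F : Pt d → G} (hF : PiecewiseContDiff n s C F) {i : ι} (hi : i ∈ s) :
    ∃ q : Pt d → G, ContDiff ℝ n q ∧ ∀ x ∈ interior (C i), F =ᶠ[𝓝 x] q := by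
  obtain ⟨q, hq, h⟩ := hF i hi
  refine ⟨q, hq, fun x hx => ?_⟩
  filter_upwards [isOpen_interior.mem_nhds hx] with y hy using h (interior_subset hy)

theorem PiecewiseContDiff.differentiableAt {G : Type*} [NormedAddCommGroup G] [NormedSpace ℝ G]
    {F : Pt d → G} (hF : PiecewiseContDiff 1 s C F) {i : ι} (hi : i ∈ s) {x : Pt d}
    (hx : x ∈ interior (C i)) : DifferentiableAt ℝ F x := by
  obtain ⟨q, hq, h⟩ := hF.eventuallyEq hi
  exact ((hq.differentiable one_ne_zero) x).congr_of_eventuallyEq (h x hx)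

/-- The gradient may jump across faces, so agreement with a continuous function survives only in the
interiors. -/
theorem PiecewiseContDiff.gradient {U : Pt d → ℝ} (hU : PiecewiseContDiff 1 s C U) :
    PiecewiseContinuous s C (gradient U) := by
  intro i hi
  obtain ⟨q, hq, h⟩ := hU.eventuallyEq hi
  exact ⟨_, continuous_gradient hq, fun x hx => (h x hx).gradient_eq⟩

theorem PiecewiseContDiff.laplacian {U : Pt d → ℝ} (hU : PiecewiseContDiff 2 s C U) :
    PiecewiseContinuous s C (Laplacian.laplacian U) := by
  intro i hi
  obtain ⟨q, hq, h⟩ := hU.eventuallyEq hi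
  exact ⟨_, continuous_laplacian hq,
    fun x hx => (InnerProductSpace.laplacian_congr_nhds (h x hx)).eq_of_nhds⟩

theorem PiecewiseContDiff.divergence {F : Pt d → Pt d} (hF : PiecewiseContDiff 1 s C F) :
    PiecewiseContinuous s C (divergence F) := by
  intro i hi
  obtain ⟨q, hq, h⟩ := hF.eventuallyEq hi
  exact ⟨_, continuous_divergence hq,
    fun x hx => by simp only [ALESUPG.divergence, (h x hx).fderiv_eq]⟩

namespace IsCellFamily

theorem memLp (h : IsCellFamily s C) {F : Pt d → ℝ} (hF : PiecewiseContinuous s C F) {i : ι}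
    (hi : i ∈ s) : MemLp F 2 (volume.restrict (C i)) :=
  let ⟨_, hq, hFq⟩ := hF i hi
  h.memLp_of_eqOn_interior hi hq.continuousOn hFq

theorem integrableOn (h : IsCellFamily s C) {F : Pt d → ℝ} (hF : PiecewiseContinuous s C F) {i : ι}
    (hi : i ∈ s) : IntegrableOn F (C i) := by
  have hfin : IsFiniteMeasure ((volume : Measure (Pt d)).restrict (C i)) :=
    ⟨by simpa using (h.isCompact i hi).measure_lt_top⟩
  exact (h.memLp hF hi).integrable one_le_two

theorem integrableOn_domain (h : IsCellFamily s C) {F : Pt d → ℝ}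
    (hF : PiecewiseContinuous s C F) : IntegrableOn F (⋃ i ∈ s, C i) :=
  h.integrableOn_biUnion fun _ hi => h.integrableOn hF hi

theorem memLp_domain (h : IsCellFamily s C) {F : Pt d → ℝ}
    (hF : PiecewiseContinuous s C F) : MemLp F 2 (volume.restrict (⋃ i ∈ s, C i)) := by
  rw [memLp_two_iff_integrable_sq (h.integrableOn_domain hF).aestronglyMeasurable]
  simp only [sq]
  exact h.integrableOn_domain (hF.mul hF)

end IsCellFamily

/-! ### Integration by parts -/

theorem divergence_smul {U : Pt d → ℝ} {F : Pt d → Pt d} {x : Pt d}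
    (hU : DifferentiableAt ℝ U x) (hF : DifferentiableAt ℝ F x) :
    divergence (fun y => U y • F y) x = ⟪F x, gradient U x⟫ + U x * divergence F x := by
  have h1 : ⟪F x, gradient U x⟫ = fderiv ℝ U x (F x) := by
    rw [real_inner_comm, gradient, InnerProductSpace.toDual_symm_apply]
  have h2 : F x = ∑ i, F x i • EuclideanSpace.single i (1 : ℝ) := by
    ext j
    simp [Finset.sum_apply, Pi.single_apply]
  have h3 : fderiv ℝ U x (F x)
      = ∑ i, F x i * fderiv ℝ U x (EuclideanSpace.single i (1 : ℝ)) := by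
    conv_lhs => rw [h2]
    simp [map_sum]
  rw [h1, h3, divergence, divergence, Finset.mul_sum, ← Finset.sum_add_distrib]
  refine Finset.sum_congr rfl fun i _ => ?_
  rw [fderiv_fun_smul hU hF]
  simp
  ring

namespace IsCellFamily

/-- The field `U² F` vanishes on the boundary, so its divergence `2 U F·∇U + U² ∇·F` has integral
zero. Applied to the convection `b`, and through the next lemma to the mesh velocity. -/
theorem integral_inner_gradient_mul (h : IsCellFamily s C) {U : Pt d → ℝ} {F : Pt d → Pt d}
    (hU : PiecewiseContDiff 1 s C U) (hF : PiecewiseContDiff 1 s C F)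
    (h0 : ∀ x ∈ frontier (⋃ i ∈ s, C i), U x = 0) :
    ∫ x in ⋃ i ∈ s, C i, ⟪F x, gradient U x⟫ * U x
      = -(1 / 2) * ∫ x in ⋃ i ∈ s, C i, U x ^ 2 * divergence F x := by
  have hUF := hU.smul hF
  have hdiv := h.integral_divergence_eq_zero (hU.smul hUF) fun x hx => by simp [h0 x hx]
  have hae : ∀ᵐ x ∂volume.restrict (⋃ i ∈ s, C i), divergence (fun y => U y • U y • F y) x
      = 2 * (⟪F x, gradient U x⟫ * U x) + U x ^ 2 * divergence F x := by
    refine h.ae_biUnion fun i hi x hx => ?_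
    rw [divergence_smul (hU.differentiableAt hi hx) (hUF.differentiableAt hi hx),
      divergence_smul (hU.differentiableAt hi hx) (hF.differentiableAt hi hx),
      real_inner_smul_left]
    ring
  have hint1 := h.integrableOn_domain ((hF.continuous.inner hU.gradient).mul hU.continuous)
  have hint2 : IntegrableOn (fun x => U x ^ 2 * divergence F x) (⋃ i ∈ s, C i) := by
    simpa only [sq] using
      h.integrableOn_domain ((hU.continuous.mul hU.continuous).mul hF.divergence)
  rw [integral_congr_ae hae, integral_add (hint1.const_mul 2) hint2, integral_const_mul] at hdiv
  linarith

theorem integral_divergence_smul_mul (h : IsCellFamily s C) {U : Pt d → ℝ} {F : Pt d → Pt d}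
    (hU : PiecewiseContDiff 1 s C U) (hF : PiecewiseContDiff 1 s C F)
    (h0 : ∀ x ∈ frontier (⋃ i ∈ s, C i), U x = 0) :
    ∫ x in ⋃ i ∈ s, C i, divergence (fun y => U y • F y) x * U x
      = 1 / 2 * ∫ x in ⋃ i ∈ s, C i, U x ^ 2 * divergence F x := by
  have hae : ∀ᵐ x ∂volume.restrict (⋃ i ∈ s, C i), divergence (fun y => U y • F y) x * U x
      = ⟪F x, gradient U x⟫ * U x + U x ^ 2 * divergence F x := by
    refine h.ae_biUnion fun i hi x hx => ?_
    rw [divergence_smul (hU.differentiableAt hi hx) (hF.differentiableAt hi hx)]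
    ring
  have hint1 := h.integrableOn_domain ((hF.continuous.inner hU.gradient).mul hU.continuous)
  have hint2 : IntegrableOn (fun x => U x ^ 2 * divergence F x) (⋃ i ∈ s, C i) := by
    simpa only [sq] using
      h.integrableOn_domain ((hU.continuous.mul hU.continuous).mul hF.divergence)
  rw [integral_congr_ae hae, integral_add hint1 hint2, h.integral_inner_gradient_mul hU hF h0]
  ring

end IsCellFamily

end Piecewise

/-! ### Estimates for the stabilized form -/

theorem abs_le_supNorm {d : ℕ} {S : Set (Pt d)} (hS : IsCompact S) {c : Pt d → ℝ}
    (hc : Continuous c) {x : Pt d} (hx : x ∈ S) : |c x| ≤ supNorm S c :=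
  le_csSup (hS.bddAbove_image hc.abs.continuousOn) (mem_image_of_mem _ hx)

section Supg

variable {d : ℕ} {T : Mesh d} {a : Pt d → Pt d}

/-- Lower bound for the stabilization term of a single cell. -/
theorem stabilization_lower_bound (ha : IsCellwiseAffine T a) {K : Finset (Pt d)}
    (hK : K ∈ T.cells) {ε μ cinv δ : ℝ} (hε : 0 < ε) (hδ0 : 0 ≤ δ) {β : Pt d → Pt d} {c U : Pt d → ℝ}
    (hβ : PiecewiseContinuous T.cells (fun K => a '' cell K) β) (hc : Continuous c)
    (hU : PiecewiseContDiff 2 T.cells (fun K => a '' cell K) U)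
    (hinv : (∫ x in a '' cell K, (Laplacian.laplacian U x) ^ 2)
      ≤ (cinv / Metric.diam (a '' cell K)) ^ 2 * ∫ x in a '' cell K, ‖gradient U x‖ ^ 2)
    (hδc : δ * (2 * supNorm (a '' cell K) c ^ 2) ≤ μ)
    (hδh : δ * (2 * ε * cinv ^ 2) ≤ Metric.diam (a '' cell K) ^ 2) :
    1 / 2 * (δ * l2sq (a '' cell K) fun x => ⟪β x, gradient U x⟫)
        - ε / 2 * (∫ x in a '' cell K, ‖gradient U x‖ ^ 2)
        - μ / 2 * ∫ x in a '' cell K, U x ^ 2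
      ≤ δ * ∫ x in a '' cell K,
        (-ε * Laplacian.laplacian U x + ⟪β x, gradient U x⟫ + c x * U x) * ⟪β x, gradient U x⟫ := by
  have h := ha.isCellFamily
  have hU1 : PiecewiseContDiff 1 T.cells (fun K => a '' cell K) U := hU.of_le one_le_two
  have hD := hβ.inner hU1.gradient
  have hL := hU.laplacian
  have hUc := hU1.continuous
  have hcU := (hc.piecewiseContinuous (s := T.cells) (C := fun K => a '' cell K)).mul hUc
  have hεL := ((continuous_const (y := -ε)).piecewiseContinuous
    (s := T.cells) (C := fun K => a '' cell K)).mul hL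
  have iD := (h.memLp hD hK).integrable_sq
  have iL := (h.memLp hL hK).integrable_sq
  have iU := (h.memLp hUc hK).integrable_sq
  have iT := h.integrableOn (((hεL.add hD).add hcU).mul hD) hK
  have hmeas := (h.isCompact K hK).measurableSet
  set m := supNorm (a '' cell K) c
  have iDL : Integrable (fun x => 1 / 2 * ⟪β x, gradient U x⟫ ^ 2
      - ε ^ 2 * (Laplacian.laplacian U x) ^ 2) (volume.restrict (a '' cell K)) :=
    (iD.const_mul _).sub (iL.const_mul _)
  -- Write `D = β·∇U`. Young's inequality gives `εΔU·D ≤ ε²(ΔU)² + D²/4` and `-cU·D ≤ c²U² + D²/4`,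
  -- so half of `D²` is left.
  have hpt : ∫ x in a '' cell K, (1 / 2 * ⟪β x, gradient U x⟫ ^ 2
        - ε ^ 2 * (Laplacian.laplacian U x) ^ 2 - m ^ 2 * U x ^ 2)
      ≤ ∫ x in a '' cell K,
        (-ε * Laplacian.laplacian U x + ⟪β x, gradient U x⟫ + c x * U x) * ⟪β x, gradient U x⟫ := by
    refine setIntegral_mono_on (iDL.sub (iU.const_mul _)) iT hmeas fun x hx => ?_
    have hcm : c x ^ 2 ≤ m ^ 2 := by
      rw [← sq_abs (c x)]
      gcongr
      exact abs_le_supNorm (h.isCompact K hK) hc hx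
    nlinarith [sq_nonneg (ε * Laplacian.laplacian U x - ⟪β x, gradient U x⟫ / 2),
      sq_nonneg (c x * U x + ⟪β x, gradient U x⟫ / 2),
      mul_le_mul_of_nonneg_right hcm (sq_nonneg (U x))]
  rw [integral_sub iDL (iU.const_mul _),
    integral_sub (iD.const_mul _) (iL.const_mul _), integral_const_mul, integral_const_mul,
    integral_const_mul] at hpt
  set G := ∫ x in a '' cell K, ‖gradient U x‖ ^ 2
  set V := ∫ x in a '' cell K, U x ^ 2
  set Λ := ∫ x in a '' cell K, (Laplacian.laplacian U x) ^ 2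
  have hG : 0 ≤ G := integral_nonneg fun x => by positivity
  have hV : 0 ≤ V := integral_nonneg fun x => by positivity
  -- This is `hδh` times `ε / 2`, divided by the squared diameter. For diameter zero the quotient is
  -- zero by convention and the bound is trivial.
  have hr : δ * ε ^ 2 * (cinv / Metric.diam (a '' cell K)) ^ 2 ≤ ε / 2 := by
    rcases eq_or_ne (Metric.diam (a '' cell K)) 0 with h0 | h0
    · rw [h0]
      simp only [div_zero]
      nlinarith
    · have hpos : 0 < Metric.diam (a '' cell K) ^ 2 := by positivity
      rw [div_pow, mul_div_assoc', div_le_iff₀ hpos]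
      nlinarith
  have e1 : δ * ε ^ 2 * Λ ≤ ε / 2 * G := by
    calc δ * ε ^ 2 * Λ ≤ δ * ε ^ 2 * ((cinv / Metric.diam (a '' cell K)) ^ 2 * G) := by gcongr
      _ = δ * ε ^ 2 * (cinv / Metric.diam (a '' cell K)) ^ 2 * G := by ring
      _ ≤ ε / 2 * G := by gcongr
  have e2 : δ * m ^ 2 * V ≤ μ / 2 * V := by
    gcongr
    linarith
  have e3 := mul_le_mul_of_nonneg_left hpt hδ0
  unfold l2sq
  linarith

/-- The Galerkin part yields the full diffusion and, after integration by parts of the convection,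
at least `μ‖U‖²`. Summing `stabilization_lower_bound` over the cells takes away at most half of both
and adds half of the streamline term. -/
theorem supgForm_coercive (ha : IsCellwiseAffine T a) {δ : Finset (Pt d) → ℝ} {ε μ cinv : ℝ}
    (hε : 0 < ε) {b β : Pt d → Pt d} {c U : Pt d → ℝ} (hb : ContDiff ℝ 1 b)
    (hβ : PiecewiseContinuous T.cells (fun K => a '' cell K) β) (hc : Continuous c)
    (hU : PiecewiseContDiff 2 T.cells (fun K => a '' cell K) U)
    (h0 : ∀ x ∈ frontier (a '' T.domain), U x = 0)
    (hpos : ∀ x ∈ a '' T.domain, μ ≤ c x - 1 / 2 * divergence b x)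
    (hδ0 : ∀ K ∈ T.cells, 0 ≤ δ K)
    (hinv : ∀ K ∈ T.cells, (∫ x in a '' cell K, (Laplacian.laplacian U x) ^ 2)
      ≤ (cinv / Metric.diam (a '' cell K)) ^ 2 * ∫ x in a '' cell K, ‖gradient U x‖ ^ 2)
    (hδc : ∀ K ∈ T.cells, δ K * (2 * supNorm (a '' cell K) c ^ 2) ≤ μ)
    (hδh : ∀ K ∈ T.cells, δ K * (2 * ε * cinv ^ 2) ≤ Metric.diam (a '' cell K) ^ 2) :
    1 / 2 * supgNormSq T a δ ε μ β U ≤ supgForm T a δ ε b β c U U := by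
  have h := ha.isCellFamily
  have hΩ := ha.image_domain
  have hU1 : PiecewiseContDiff 1 T.cells (fun K => a '' cell K) U := hU.of_le one_le_two
  have hUc := hU1.continuous
  have hU2 : PiecewiseContinuous T.cells (fun K => a '' cell K) fun x => U x ^ 2 := by
    simpa only [sq] using hUc.mul hUc
  have hG2 : PiecewiseContinuous T.cells (fun K => a '' cell K) fun x => ‖gradient U x‖ ^ 2 := by
    simpa only [← real_inner_self_eq_norm_sq] using hU1.gradient.inner hU1.gradient
  have hbC : PiecewiseContDiff 1 T.cells (fun K => a '' cell K) b :=
    fun _ _ => ⟨b, hb, fun _ _ => rfl⟩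
  have hcp := hc.piecewiseContinuous (s := T.cells) (C := fun K => a '' cell K)
  have hmeas : MeasurableSet (⋃ K ∈ T.cells, a '' cell K) := h.isCompact_biUnion.measurableSet
  have hskew := h.integral_inner_gradient_mul hU1 hbC (by rwa [hΩ] at h0)
  have hreact : μ * (∫ x in ⋃ K ∈ T.cells, a '' cell K, U x ^ 2)
      ≤ (∫ x in ⋃ K ∈ T.cells, a '' cell K, c x * U x * U x)
        - 1 / 2 * ∫ x in ⋃ K ∈ T.cells, a '' cell K, U x ^ 2 * divergence b x := by
    have i1 := h.integrableOn_domain ((hcp.mul hUc).mul hUc)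
    have i2 := h.integrableOn_domain (hU2.mul hbC.divergence)
    rw [← integral_const_mul, ← integral_const_mul, ← integral_sub i1 (i2.const_mul _)]
    refine setIntegral_mono_on ((h.integrableOn_domain hU2).const_mul _)
      (i1.sub (i2.const_mul _)) hmeas fun x hx => ?_
    have := hpos x (by rwa [hΩ])
    nlinarith [mul_le_mul_of_nonneg_right this (sq_nonneg (U x))]
  have hstab := Finset.sum_le_sum fun K hK => stabilization_lower_bound ha hK hε (hδ0 K hK) hβ hc hU
    (hinv K hK) (hδc K hK) (hδh K hK)
  rw [Finset.sum_sub_distrib, Finset.sum_sub_distrib, ← Finset.mul_sum, ← Finset.mul_sum,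
    ← Finset.mul_sum, ← h.integral_biUnion fun K hK => h.integrableOn hG2 hK,
    ← h.integral_biUnion fun K hK => h.integrableOn hU2 hK] at hstab
  unfold supgForm supgNormSq
  simp only [hΩ, real_inner_self_eq_norm_sq]
  rw [hskew]
  simp only [l2sq] at hstab ⊢
  linarith

/-- The Young weights `fU ≤ f²/μ + (μ/4)U²` and `fD ≤ f² + D²/4`, with `D = β·∇U`, are chosen so
that exactly a quarter of the reaction and streamline parts of the norm is spent. -/
theorem load_upper_bound (ha : IsCellwiseAffine T a) {δ : Finset (Pt d) → ℝ} {ε μ : ℝ}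
    (hε : 0 < ε) (hμ : 0 < μ) {β : Pt d → Pt d} {f U : Pt d → ℝ}
    (hβ : PiecewiseContinuous T.cells (fun K => a '' cell K) β)
    (hU : PiecewiseContDiff 1 T.cells (fun K => a '' cell K) U)
    (hf : MemLp f 2 (volume.restrict (a '' T.domain))) (hδ0 : ∀ K ∈ T.cells, 0 ≤ δ K) :
    (∫ x in a '' T.domain, f x * U x)
        + ∑ K ∈ T.cells, δ K * ∫ x in a '' cell K, f x * ⟪β x, gradient U x⟫
      ≤ 1 / 4 * supgNormSq T a δ ε μ β U + 1 / μ * l2sq (a '' T.domain) f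
        + ∑ K ∈ T.cells, δ K * l2sq (a '' T.domain) f := by
  have h := ha.isCellFamily
  have hUΩ : MemLp U 2 (volume.restrict (a '' T.domain)) := by
    rw [ha.image_domain]
    exact h.memLp_domain hU.continuous
  have hD := hβ.inner hU.gradient
  have hvol : (∫ x in a '' T.domain, f x * U x)
      ≤ 1 / μ * l2sq (a '' T.domain) f + μ / 4 * l2sq (a '' T.domain) U := by
    unfold l2sq
    rw [← integral_const_mul, ← integral_const_mul,
      ← integral_add (hf.integrable_sq.const_mul _) (hUΩ.integrable_sq.const_mul _)]
    refine integral_mono (hf.integrable_mul hUΩ)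
      ((hf.integrable_sq.const_mul _).add (hUΩ.integrable_sq.const_mul _)) fun x => ?_
    have : 1 / μ * f x ^ 2 + μ / 4 * U x ^ 2 - f x * U x = (1 / μ) * (f x - μ / 2 * U x) ^ 2 := by
      field_simp
      ring
    have h2 : 0 ≤ (1 / μ) * (f x - μ / 2 * U x) ^ 2 := by positivity
    change f x * U x ≤ 1 / μ * f x ^ 2 + μ / 4 * U x ^ 2
    linarith
  have hcell : ∀ K ∈ T.cells, δ K * (∫ x in a '' cell K, f x * ⟪β x, gradient U x⟫)
      ≤ δ K * l2sq (a '' T.domain) f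
        + 1 / 4 * (δ K * l2sq (a '' cell K) fun x => ⟪β x, gradient U x⟫) := by
    intro K hK
    have hsub : a '' cell K ⊆ a '' T.domain := image_mono (T.cell_subset_domain hK)
    have hfK : MemLp f 2 (volume.restrict (a '' cell K)) :=
      hf.mono_measure (Measure.restrict_mono hsub le_rfl)
    have hDK := h.memLp hD hK
    -- The norm of `f` over the cell is enlarged to the whole domain, which is the form of the final
    -- estimate.
    have hmono : l2sq (a '' cell K) f ≤ l2sq (a '' T.domain) f :=
      setIntegral_mono_set hf.integrable_sq (Eventually.of_forall fun x => sq_nonneg (f x))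
        hsub.eventuallyLE
    have hle : (∫ x in a '' cell K, f x * ⟪β x, gradient U x⟫)
        ≤ l2sq (a '' cell K) f + 1 / 4 * l2sq (a '' cell K) fun x => ⟪β x, gradient U x⟫ := by
      unfold l2sq
      rw [← integral_const_mul, ← integral_add hfK.integrable_sq (hDK.integrable_sq.const_mul _)]
      refine integral_mono (hfK.integrable_mul hDK)
        (hfK.integrable_sq.add (hDK.integrable_sq.const_mul _)) fun x => ?_
      change f x * ⟪β x, gradient U x⟫ ≤ f x ^ 2 + 1 / 4 * ⟪β x, gradient U x⟫ ^ 2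
      nlinarith [sq_nonneg (f x - ⟪β x, gradient U x⟫ / 2)]
    nlinarith [mul_le_mul_of_nonneg_left (hle.trans (add_le_add_left hmono _)) (hδ0 K hK)]
  have hsum := Finset.sum_le_sum hcell
  rw [Finset.sum_add_distrib, ← Finset.mul_sum] at hsum
  have hG : 0 ≤ ε * ∫ x in a '' T.domain, ‖gradient U x‖ ^ 2 :=
    mul_nonneg hε.le (integral_nonneg fun x => by positivity)
  unfold supgNormSq
  linarith

end Supg

/-! ### Stability of the scheme -/

theorem contDiff_eval_mvPolynomial {d : ℕ} (p : MvPolynomial (Fin d) ℝ) {k : WithTop ℕ∞} :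
    ContDiff ℝ k fun x : Pt d => MvPolynomial.eval (fun i => x i) p := by
  induction p using MvPolynomial.induction_on with
  | C r => simpa using contDiff_const
  | add p q hp hq => simpa using hp.add hq
  | mul_X p i hp =>
    simp only [map_mul, MvPolynomial.eval_X]
    exact hp.mul (by fun_prop)

theorem IsConforming.piecewiseContDiff {d : ℕ} {T : Mesh d} {Δt : ℝ} {N : ℕ} {A : ℝ → Pt d → Pt d}
    {V : Submodule ℝ (Pt d → ℝ)} (hV : IsConforming T Δt N A V) {v : Pt d → ℝ} (hv : v ∈ V)
    {k : WithTop ℕ∞} : PiecewiseContDiff k T.cells cell v := fun K hK =>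
  let ⟨p, hp⟩ := hV.polynomial v hv K hK
  ⟨_, contDiff_eval_mvPolynomial p, hp⟩

/-! ### Change of the mass over one time step. -/

section Mass

variable {d : ℕ} {T : Mesh d}

theorem IsCellwiseAffine.integral_mul_le {a : Pt d → Pt d} (ha : IsCellwiseAffine T a)
    {v w : Pt d → ℝ} (hv : PiecewiseContinuous T.cells (fun K => a '' cell K) v)
    (hw : PiecewiseContinuous T.cells (fun K => a '' cell K) w) :
    ∫ x in a '' T.domain, v x * w x
      ≤ 1 / 2 * l2sq (a '' T.domain) v + 1 / 2 * l2sq (a '' T.domain) w := by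
  rw [ha.image_domain]
  have mv := ha.isCellFamily.memLp_domain hv
  have mw := ha.isCellFamily.memLp_domain hw
  unfold l2sq
  rw [← integral_const_mul, ← integral_const_mul,
    ← integral_add (mv.integrable_sq.const_mul _) (mw.integrable_sq.const_mul _)]
  refine integral_mono (mv.integrable_mul mw)
    ((mv.integrable_sq.const_mul _).add (mw.integrable_sq.const_mul _)) fun x => ?_
  change v x * w x ≤ 1 / 2 * v x ^ 2 + 1 / 2 * w x ^ 2
  nlinarith [sq_nonneg (v x - w x)]

/-- Squaring commutes with transport, so the squared norm is a sum of integrals of a transported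
function, as `integral_gridCell_sub` requires. -/
theorem IsCellwiseAffine.l2sq_eulerian {a : Pt d → Pt d} (ha : IsCellwiseAffine T a)
    {v : Pt d → ℝ} (hv : PiecewiseContDiff 0 T.cells cell v) :
    l2sq (a '' T.domain) (eulerian T a v)
      = ∑ K ∈ T.cells, ∫ x in a '' cell K, eulerian T a (fun Y => v Y ^ 2) x := by
  have hE := (ha.piecewiseContDiff_eulerian hv).continuous
  rw [l2sq, ha.image_domain]
  exact ha.isCellFamily.integral_biUnion fun K hK => (ha.isCellFamily.memLp hE hK).integrable_sq

theorem IsALEMotion.l2sq_sub {Δt : ℝ} {N : ℕ} {A : ℝ → Pt d → Pt d} (hA : IsALEMotion T Δt N A)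
    (hΔt : 0 < Δt) (hG : GCL T Δt N A) {n : ℕ} (hn : n ≤ N) {v : Pt d → ℝ}
    (hv : PiecewiseContDiff 0 T.cells cell v) :
    l2sq (gridDomain T Δt A (n + 1)) (eulerian T (A (gridTime Δt (n + 1))) v)
        - l2sq (gridDomain T Δt A n) (eulerian T (A (gridTime Δt n)) v)
      = Δt * ∫ x in midDomain T Δt A n,
          eulerian T (midMap Δt A n) v x ^ 2 * divergence (meshVelocity T Δt A n) x := by
  have hm := hA.isCellwiseAffine_midMap hΔt hn
  have hE := (hm.piecewiseContDiff_eulerian hv).continuous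
  have hint := (hE.mul hE).mul (hA.piecewiseContDiff_meshVelocity hΔt hn (k := 1)).divergence
  simp only [← sq] at hint
  rw [gridDomain, gridDomain, (hA.isCellwiseAffine_grid_succ hΔt hn).l2sq_eulerian hv,
    (hA.isCellwiseAffine_grid hΔt hn).l2sq_eulerian hv, ← Finset.sum_sub_distrib, midDomain,
    hm.image_domain, hm.isCellFamily.integral_biUnion fun K hK =>
      hm.isCellFamily.integrableOn hint hK, Finset.mul_sum]
  exact Finset.sum_congr rfl fun K hK =>
    hA.integral_gridCell_sub hΔt hG hn hK fun Y => v Y ^ 2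

end Mass

/-- The energy estimate for one time step. -/
theorem SchemeStep.energy_le {d : ℕ} {T : Mesh d} {N : ℕ} {Δt : ℝ} (hΔt : 0 < Δt)
    {A : ℝ → Pt d → Pt d} (hA : IsALEMotion T Δt N A) (hG : GCL T Δt N A)
    {V : Submodule ℝ (Pt d → ℝ)} (hV : IsConforming T Δt N A V)
    {ε μ : ℝ} (hε : 0 < ε) (hμ : 0 < μ) {b : ℝ → Pt d → Pt d} {c f : ℝ → Pt d → ℝ}
    (hb : ∀ t ∈ Icc 0 (gridTime Δt (N + 1)), ContDiff ℝ 1 (b t))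
    (hc : ∀ t ∈ Icc 0 (gridTime Δt (N + 1)), Continuous (c t))
    {n : ℕ} (hn : n ≤ N)
    (hf : MemLp (f (midTime Δt n)) 2 (volume.restrict (midDomain T Δt A n)))
    (hpos : ∀ x ∈ midDomain T Δt A n,
      μ ≤ c (midTime Δt n) x - 1 / 2 * divergence (b (midTime Δt n)) x)
    {δ : Finset (Pt d) → ℝ} (hδ0 : ∀ K ∈ T.cells, 0 ≤ δ K)
    {cinv : ℝ} (hcinv : IsInverseConstant T Δt N A V cinv)
    (hδc : ∀ K ∈ T.cells, δ K * (2 * supNorm (midCell Δt A n K) (c (midTime Δt n)) ^ 2) ≤ μ)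
    (hδh : ∀ K ∈ T.cells, δ K * (2 * ε * cinv ^ 2) ≤ Metric.diam (midCell Δt A n K) ^ 2)
    {s : ℕ → ℝ} (hs : s n ∈ Icc (gridTime Δt n) (gridTime Δt (n + 1)))
    {u : ℕ → Pt d → ℝ} (hu₀ : u n ∈ V) (hu₁ : u (n + 1) ∈ V)
    (hstep : SchemeStep T Δt A V δ ε b c f s u n) :
    l2sq (gridDomain T Δt A (n + 1)) (eulerian T (A (gridTime Δt (n + 1))) (u (n + 1)))
      + Δt / 2 * supgNormSq T (midMap Δt A n) δ ε μ (relVelocity T Δt A b s n)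
          (eulerian T (midMap Δt A n) (u (n + 1)))
    ≤ l2sq (gridDomain T Δt A n) (eulerian T (A (gridTime Δt n)) (u n))
      + 2 * Δt / μ * l2sq (midDomain T Δt A n) (f (midTime Δt n))
      + 2 * Δt * ∑ K ∈ T.cells, δ K * l2sq (midDomain T Δt A n) (f (midTime Δt n)) := by
  have hm := hA.isCellwiseAffine_midMap hΔt hn
  have ha₀ := hA.isCellwiseAffine_grid hΔt hn
  have htime := Icc_gridTime_subset hΔt hn
  have hbm := hb _ (htime (midTime_mem_Icc hΔt n))
  have hcm := hc _ (htime (midTime_mem_Icc hΔt n))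
  have hU2 : PiecewiseContDiff 2 T.cells (fun K => midMap Δt A n '' cell K)
      (eulerian T (midMap Δt A n) (u (n + 1))) :=
    hm.piecewiseContDiff_eulerian (hV.piecewiseContDiff hu₁)
  have hU1 := hU2.of_le one_le_two
  have hw : PiecewiseContDiff 1 T.cells (fun K => midMap Δt A n '' cell K)
      (meshVelocity T Δt A n) := hA.piecewiseContDiff_meshVelocity hΔt hn
  have hβ : PiecewiseContinuous T.cells (fun K => midMap Δt A n '' cell K)
      (relVelocity T Δt A b s n) :=
    (hb _ (htime hs)).continuous.piecewiseContinuous.sub hw.continuous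
  have h0 : ∀ x ∈ frontier (midMap Δt A n '' T.domain),
      eulerian T (midMap Δt A n) (u (n + 1)) x = 0 :=
    hV.zero_moved _ hu₁ n hn _ (midTime_mem_Icc hΔt n)
  have hcoer := supgForm_coercive hm hε hbm hβ hcm hU2 h0 hpos hδ0
    (fun K hK => hcinv.2 n hn K hK _ hu₁) hδc hδh
  have hload := load_upper_bound hm hε hμ hβ hU1 hf hδ0
  have hconv := hm.isCellFamily.integral_divergence_smul_mul hU1 hw (by rwa [← hm.image_domain])
  rw [← hm.image_domain] at hconv
  have hmass := hA.l2sq_sub hΔt hG hn (hV.piecewiseContDiff hu₁)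
  -- The mixed product lives on the old domain, where the test function `u (n + 1)` is transported
  -- by the map at `t^n`.
  have hyoung := ha₀.integral_mul_le
    (ha₀.piecewiseContDiff_eulerian (hV.piecewiseContDiff hu₀ (k := 0))).continuous
    (ha₀.piecewiseContDiff_eulerian (hV.piecewiseContDiff hu₁ (k := 0))).continuous
  have heq := hstep (u (n + 1)) hu₁
  have hsq : (∫ x in gridDomain T Δt A (n + 1),
      eulerian T (A (gridTime Δt (n + 1))) (u (n + 1)) x
        * eulerian T (A (gridTime Δt (n + 1))) (u (n + 1)) x)
      = l2sq (gridDomain T Δt A (n + 1)) (eulerian T (A (gridTime Δt (n + 1))) (u (n + 1))) := by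
    simp only [l2sq, sq]
  simp only [hsq] at heq
  simp only [gridDomain, midDomain, midCell] at *
  rw [hconv] at heq
  have heq' := congrArg (fun r => Δt * r) heq
  simp only [mul_add, mul_sub, ← mul_assoc, mul_one_div_cancel hΔt.ne', one_mul] at heq'
  have hload' := mul_le_mul_of_nonneg_left hload hΔt.le
  have hcoer' := mul_le_mul_of_nonneg_left hcoer hΔt.le
  -- Doubled, `hyoung` produces the squared norm of `u (n + 1)` on the old domain. Exchanging it for
  -- the one on the new domain by `hmass` releases `Δt ∫ u² ∇·w_h`, which cancels the mesh velocity
  -- term of `heq'`.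
  linear_combination 2 * heq' + 2 * hload' + 2 * hcoer' + 2 * hyoung - hmass

end

end ALESUPG

theorem lemma3 {d : ℕ} (hd1 : 1 ≤ d) (hd3 : d ≤ 3)
    -- mesh, time grid with `N + 1` steps, ALE motion; for `d ≤ 2` the midpoint rule is always
    -- exact for the volume of the cells, for `d = 3` this is required
    (T : Mesh d) (N : ℕ) (Δt : ℝ) (hΔt : 0 < Δt)
    (A : ℝ → Pt d → Pt d) (hA : IsALEMotion T Δt N A)
    (hGCL : d = 3 → GCL T Δt N A)
    -- finite element space
    (V : Submodule ℝ (Pt d → ℝ)) [FiniteDimensional ℝ V] (hV : IsConforming T Δt N A V)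
    -- data
    (ε μ : ℝ) (hε : 0 < ε) (hμ : 0 < μ)
    (b : ℝ → Pt d → Pt d) (c f : ℝ → Pt d → ℝ)
    (hb : ∀ t ∈ Set.Icc 0 (gridTime Δt (N + 1)), ContDiff ℝ 1 (b t))
    (hc : ∀ t ∈ Set.Icc 0 (gridTime Δt (N + 1)), Continuous (c t))
    (hf : ∀ n ≤ N, MemLp (f (midTime Δt n)) 2 (volume.restrict (midDomain T Δt A n)))
    -- positivity assumption
    (hpos : ∀ n ≤ N, ∀ x ∈ midDomain T Δt A n,
      μ ≤ c (midTime Δt n) x - 1 / 2 * divergence (b (midTime Δt n)) x)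
    -- bounds on the stabilization parameters
    (δ : Finset (Pt d) → ℝ) (hδ0 : ∀ K ∈ T.cells, 0 ≤ δ K)
    (cinv : ℝ) (hcinv : IsInverseConstant T Δt N A V cinv)
    (hδc : ∀ n ≤ N, ∀ K ∈ T.cells,
      δ K * (2 * supNorm (midCell Δt A n K) (c (midTime Δt n)) ^ 2) ≤ μ)
    (hδh : ∀ n ≤ N, ∀ K ∈ T.cells,
      δ K * (2 * ε * cinv ^ 2) ≤ Metric.diam (midCell Δt A n K) ^ 2)
    (hδt : ∀ K ∈ T.cells, δ K ≤ Δt / 4)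
    -- times at which `b` is evaluated in the stabilization terms
    (s : ℕ → ℝ) (hs : ∀ n ≤ N, s n ∈ Set.Icc (gridTime Δt n) (gridTime Δt (n + 1)))
    -- discrete solution
    (u : ℕ → Pt d → ℝ) (hu : ∀ n ≤ N + 1, u n ∈ V)
    (hscheme : ∀ n ≤ N, SchemeStep T Δt A V δ ε b c f s u n) :
    l2sq (gridDomain T Δt A (N + 1)) (eulerian T (A (gridTime Δt (N + 1))) (u (N + 1)))
      + Δt / 2 * ∑ n ∈ Finset.range (N + 1),
          supgNormSq T (midMap Δt A n) δ ε μ (relVelocity T Δt A b s n)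
            (eulerian T (midMap Δt A n) (u (n + 1)))
    ≤ l2sq (gridDomain T Δt A 0) (eulerian T (A (gridTime Δt 0)) (u 0))
      + 2 * Δt / μ * ∑ n ∈ Finset.range (N + 1), l2sq (midDomain T Δt A n) (f (midTime Δt n))
      + 2 * Δt * ∑ K ∈ T.cells, δ K *
          ∑ n ∈ Finset.range (N + 1), l2sq (midDomain T Δt A n) (f (midTime Δt n)) := by
  have hG : GCL T Δt N A := by
    by_cases h3 : d = 3
    · exact hGCL h3
    · exact hA.gcl hΔt (by omega)
  have hsum := Finset.sum_le_sum (s := Finset.range (N + 1)) fun n hn =>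
    have hn' : n ≤ N := Nat.lt_succ_iff.1 (Finset.mem_range.1 hn)
    (hscheme n hn').energy_le hΔt hA hG hV hε hμ hb hc hn' (hf n hn') (hpos n hn') hδ0 hcinv
      (hδc n hn') (hδh n hn') (hs n hn') (hu n (by omega)) (hu (n + 1) (by omega))
  -- The new norm in one step is the old norm in the next, so the norms at the grid times telescope.
  have htel := Finset.sum_range_sub (fun n =>
    l2sq (gridDomain T Δt A n) (eulerian T (A (gridTime Δt n)) (u n))) (N + 1)
  have hswap : ∑ K ∈ T.cells, δ K *
        ∑ n ∈ Finset.range (N + 1), l2sq (midDomain T Δt A n) (f (midTime Δt n))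
      = ∑ n ∈ Finset.range (N + 1),
        ∑ K ∈ T.cells, δ K * l2sq (midDomain T Δt A n) (f (midTime Δt n)) := by
    rw [Finset.sum_comm]
    simp only [Finset.mul_sum]
  simp only [Finset.sum_add_distrib] at hsum
  rw [← Finset.mul_sum, ← Finset.mul_sum, ← Finset.mul_sum] at hsum
  rw [Finset.sum_sub_distrib] at htel
  rw [hswap]
  linarith
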